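/- Composition is written in diagrammatic order. **Definitions.** A *restriction category* is a category with an operation assigning to $f:A\to B$ a map $\overline f:A\to A$ with $\overline f f=f$, $\overline f\,\overline g=\overline g\,\overline f$, $\overline{\overline g f}=\overline g\,\overline f$, $f\overline g=\overline{fg}f$. Hom-sets are ordered by $f\le g\iff\overline f g=f$; $f$ is *total* if $\overline f=1$. It has *restriction zeroes* if it has zero maps with $\overline 0=0$. An *interference relation* $\perp$ on such a category is a relation between maps with the same domain such that $1\perp 0$; $\perp$ is symmetric; $f\perp f$ implies $f=0$; $f'\perp g'$, $f\le f'$, $g\le g'$ imply $f\perp g$; $f\perp g$ implies $hfk\perp hgk'$; and $f\perp g$ implies $\overline f\perp\overline g$. We call $(\mathbb X,\perp)$ a *$\perp$-restriction category*. A $\perp$-join $\bigsqcup_i f_i$ is a least upper bound of a pairwise $\perp$-disjoint family of parallel maps. $\mathbb X$ *has all binary $\perp$-joins* if $f\sqcup g$ exists for parallel $f\perp g$ and $h(f\sqcup g)=hf\sqcup hg$. It is *finitely disjoint* if all finite $\perp$-joins exist, satisfy $h\bigsqcup_i f_i=\bigsqcup_i hf_i$, and are strong: if $f_i\perp h$ for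 all $i$ then $\bigsqcup_i f_i\perp h$. A *Kleene wand* $\mathbin{/\!\!/}$ on a $\perp$-restriction category with all binary $\perp$-joins assigns to $f:X\to X$, $g:X\to A$ with $f\perp g$ a map $f\mathbin{/\!\!/}g:X\to A$ such that (1) $g\sqcup f(f\mathbin{/\!\!/}g)=f\mathbin{/\!\!/}g$; (2) $(f\mathbin{/\!\!/}g)h=f\mathbin{/\!\!/}gh$; (3) $kf\mathbin{/\!\!/}kg=k(fk\mathbin{/\!\!/}g)$ for $f:X\to Y$, $g:X\to A$, $k:Y\to X$ with $f\perp g$; (4) if $f\perp f'$ and $f\sqcup f'\perp g$, then $(f\mathbin{/\!\!/}f')\perp(f\mathbin{/\!\!/}g)$ and $(f\sqcup f')\mathbin{/\!\!/}g=(f\mathbin{/\!\!/}f')\mathbin{/\!\!/}(f\mathbin{/\!\!/}g)$. A *$\perp$-itegory* is a $\perp$-restriction category with all binary $\perp$-joins and a Kleene wand. An *extensive restriction category* is a restriction category with restriction zeroes and finite coproducts whose injections are total, such that every $f:A\to B_1+\dots+B_n$ has a map $\langle f\rangle:A\to A+\dots+A$ with $\overline f=\langle f\rangle\nabla$ and $\langle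 f\rangle(f+\dots+f)=f(\iota_1+\dots+\iota_n)$. A *decision* is a $d:A\to A+\dots+A$ with $\langle d\rangle=d$. In such a category let $\iota_j^\circ$ be the quasi-projections ($\iota_j\iota_j^\circ=1$, $\iota_i\iota_j^\circ=0$ for $i\ne j$), and write $f\perp_d g$ if there is a decision $d:A\to A+A$ with $d\iota_1^\circ=\overline f$ and $d\iota_2^\circ=\overline g$. It is *traced* if it is equipped with operators $\mathsf{Tr}^X_{A,B}$ from maps $X+A\to X+B$ to maps $A\to B$ satisfying (up to the associativity isomorphisms) tightening $\mathsf{Tr}((1+g)f(1+h))=g\,\mathsf{Tr}(f)\,h$, sliding $\mathsf{Tr}(f(k+1))=\mathsf{Tr}((k+1)f)$, vanishing $\mathsf{Tr}^{X+Y}(f)=\mathsf{Tr}^Y(\mathsf{Tr}^X(f))$, superposing $\mathsf{Tr}(f+g)=\mathsf{Tr}(f)+g$, and yanking $\mathsf{Tr}(\sigma)=1$. For a finitely disjoint $\perp$-restriction category $\mathbb X$, the category $\mathsf{MAT}[(\mathbb X,\perp)]$ has as objects finite (possibly empty) lists of objects of $\mathbb X$, and as maps $(A_1,\dots,A_n)\to(B_1,\dots,B_m)$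 the $n\times m$ matrices $F$ of maps $F(i,j):A_i\to B_j$ with pairwise $\perp$-disjoint rows. Identities are diagonal, $(FG)(i,k)=\bigsqcup_jF(i,j)G(j,k)$, $\overline F$ is the diagonal matrix with entries $\bigsqcup_j\overline{F(i,j)}$, zero maps are zero matrices, and the coproduct is concatenation of lists. Let $\mathcal I:\mathbb X\to\mathsf{MAT}[(\mathbb X,\perp)]$ be $\mathcal I(A)=(A)$, $\mathcal I(f)=[f]$. **Proposition.** Let $(\mathbb X,\mathbin{/\!\!/})$ be a $\perp$-itegory whose underlying $\perp$-restriction category is finitely disjoint. Then $\mathsf{MAT}[(\mathbb X,\perp)]$ is a traced extensive restriction category, with a trace operator $\mathsf{Tr}$ satisfying the following. (a) For $F:(X)+(A)\to(X)+(B)$, $$\mathsf{Tr}^{(X)}_{(A),(B)}(F)=\bigl[\,F(2,2)\sqcup F(2,1)\bigl(F(1,1)\mathbin{/\!\!/}F(1,2)\bigr)\bigr].$$ (b) For $F:(X_1,\dots,X_n)+(A_1,\dots,A_m)\to(X_1,\dots,X_n)+(B_1,\dots,B_p)$, the $(i,j)$ entry of $\mathsf{Tr}(F)$ is computed from the rows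 $X_1,\dots,X_n,A_i$ and columns $X_1,\dots,X_n,B_j$ of $F$ by the following recursion on $n$. For $n=0$ it is the $(A_i,B_j)$ entry of $F$. For $n+1$, write these rows and columns, grouped as $(X_1,\dots,X_n)$, $X_{n+1}$, and $A_i$ resp. $B_j$, as the block matrix with rows $(S,T,U)$, $(V,f,g)$, $(W,h,k)$; then $$\mathsf{Tr}\begin{bmatrix}S&T&U\\V&f&g\\W&h&k\end{bmatrix}=k'\sqcup h'(f'\mathbin{/\!\!/}g'),$$ $$f'=\mathsf{Tr}\begin{bmatrix}S&T\\V&f\end{bmatrix},\quad g'=\mathsf{Tr}\begin{bmatrix}S&U\\V&g\end{bmatrix},\quad h'=\mathsf{Tr}\begin{bmatrix}S&T\\W&h\end{bmatrix},\quad k'=\mathsf{Tr}\begin{bmatrix}S&U\\W&k\end{bmatrix},$$ where these four traces are along $X_1,\dots,X_n$. (c) In $\mathsf{MAT}[(\mathbb X,\perp)]$ the relation $\perp_d$ is an interference relation with all binary $\perp_d$-joins, and the trace induces a Kleene wand for $\perp_d$: for $F:X\to X$ and $G:X\to A$ with $F\perp_dG$ there is a map $H:X\to X+A$ with $H\iota_1^\circ=F$,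 $H\iota_2^\circ=G$ and $F\mathbin{/\!\!/}G=\mathsf{Tr}^X_{X,A}\left(\left[\begin{smallmatrix}H\\H\end{smallmatrix}\right]\right)$. The functor $\mathcal I$ preserves Kleene wands: if $f\perp g$ in $\mathbb X$, with $f:X\to X$ and $g:X\to A$, then $\mathcal I(f)\perp_d\mathcal I(g)$ and $\mathcal I(f\mathbin{/\!\!/}g)=\mathcal I(f)\mathbin{/\!\!/}\mathcal I(g)$. -/

import Mathlib

open CategoryTheory CategoryTheory.Limits

universe v u

namespace RestrCat

/-! ### Restriction categories

Composition is written in diagrammatic order: `f ≫ g` is "first `f`, then `g`". -/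

/-- A restriction category: a category with a restriction operator. -/
class RestrictionCategory (C : Type u) [Category.{v} C] where
  /-- the restriction of a map -/
  rest : ∀ {A B : C}, (A ⟶ B) → (A ⟶ A)
  rest_comp_self : ∀ {A B : C} (f : A ⟶ B), rest f ≫ f = f
  rest_comm : ∀ {A B B' : C} (f : A ⟶ B) (g : A ⟶ B'), rest f ≫ rest g = rest g ≫ rest f
  rest_rest_comp : ∀ {A B B' : C} (f : A ⟶ B) (g : A ⟶ B'),
    rest (rest g ≫ f) = rest g ≫ rest f
  comp_rest : ∀ {A B D : C} (f : A ⟶ B) (g : B ⟶ D), f ≫ rest g = rest (f ≫ g) ≫ f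

open RestrictionCategory

/-- A restriction category has restriction zeroes if it has zero maps and the restriction of a
zero map is a zero map. -/
class RestrictionZeroes (C : Type u) [Category.{v} C] [RestrictionCategory C] extends
    HasZeroMorphisms C where
  rest_zero : ∀ A B : C, rest (0 : A ⟶ B) = 0

section Order

variable {C : Type u} [Category.{v} C] [RestrictionCategory C]

theorem rest_id (A : C) : rest (𝟙 A) = 𝟙 A := by
  have h := rest_comp_self (𝟙 A)
  rwa [Category.comp_id] at h

theorem rest_idem {A B : C} (f : A ⟶ B) : rest f ≫ rest f = rest f := by
  rw [← rest_rest_comp, rest_comp_self]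

theorem rest_rest {A B : C} (f : A ⟶ B) : rest (rest f) = rest f := by
  have h := rest_rest_comp (𝟙 A) f
  rwa [Category.comp_id, rest_id, Category.comp_id] at h

/-- `rest (f g) = rest (f g) rest f` -/
theorem rest_comp_rest {A B D : C} (f : A ⟶ B) (g : B ⟶ D) :
    rest f ≫ rest (f ≫ g) = rest (f ≫ g) := by
  rw [← rest_rest_comp, ← Category.assoc, rest_comp_self]

theorem rest_comp_eq {A B D : C} (f : A ⟶ B) (g : B ⟶ D) :
    rest (f ≫ rest g) = rest (f ≫ g) := by
  rw [comp_rest, rest_rest_comp, rest_comm, rest_comp_rest]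

/-- The canonical partial order on the hom-sets of a restriction category:
`f ≤ g` if and only if `rest f ≫ g = f`. -/
instance homOrder (A B : C) : PartialOrder (A ⟶ B) where
  le f g := rest f ≫ g = f
  le_refl f := rest_comp_self f
  le_trans f g h hfg hgh := by
    change rest f ≫ g = f at hfg
    change rest g ≫ h = g at hgh
    have h1 : rest f ≫ rest g = rest f := by
      rw [← rest_rest_comp, hfg]
    calc rest f ≫ h = rest f ≫ rest g ≫ h := by rw [← Category.assoc, h1]
      _ = f := by rw [hgh, hfg]
  le_antisymm f g hfg hgf := by
    change rest f ≫ g = f at hfg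
    change rest g ≫ f = g at hgf
    have h1 : rest f ≫ rest g = rest f := by rw [← rest_rest_comp, hfg]
    have h2 : rest g ≫ rest f = rest g := by rw [← rest_rest_comp, hgf]
    have h3 : rest f = rest g := by rw [← h1, rest_comm, h2]
    rw [← hgf, ← h3, rest_comp_self]

theorem le_def {A B : C} (f g : A ⟶ B) : f ≤ g ↔ rest f ≫ g = f := Iff.rfl

theorem comp_mono {A B D : C} {f f' : A ⟶ B} {g g' : B ⟶ D} (hf : f ≤ f') (hg : g ≤ g') :
    f ≫ g ≤ f' ≫ g' := by
  rw [le_def] at *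
  have h1 : f ≫ g ≤ f ≫ g' := by
    rw [le_def]
    conv_rhs => rw [← hg, ← Category.assoc, comp_rest, Category.assoc]
  have h2 : f ≫ g' ≤ f' ≫ g' := by
    rw [le_def, ← rest_comp_rest f g', rest_comm, Category.assoc, ← Category.assoc (rest f), hf,
      rest_comp_self]
  exact h1.trans h2

theorem rest_mono {A B : C} {f g : A ⟶ B} (h : f ≤ g) : rest f ≤ rest g := by
  rw [le_def] at *
  rw [rest_rest, ← rest_rest_comp, h]

theorem rest_le_one {A B : C} (f : A ⟶ B) : rest f ≤ 𝟙 A := by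
  rw [le_def, rest_rest, Category.comp_id]

theorem rest_of_le_one {A : C} {e : A ⟶ A} (h : e ≤ 𝟙 A) : rest e = e := by
  rwa [le_def, Category.comp_id] at h

theorem rest_comp_le {A B D : C} (f : A ⟶ B) (g : A ⟶ D) : rest g ≫ f ≤ f := by
  simpa using comp_mono (rest_le_one g) (le_refl f)

/-- `f` is total if its restriction is the identity. -/
def IsTotal {A B : C} (f : A ⟶ B) : Prop := rest f = 𝟙 A

variable [RestrictionZeroes C]

theorem zero_le' {A B : C} (f : A ⟶ B) : 0 ≤ f := by
  rw [le_def, RestrictionZeroes.rest_zero, zero_comp]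

open Classical in
/-- The least upper bound of a set of parallel maps, when it exists (and `0` otherwise). -/
noncomputable def lub {A B : C} (s : Set (A ⟶ B)) : A ⟶ B :=
  if h : ∃ j, IsLUB s j then h.choose else 0

theorem lub_eq {A B : C} {s : Set (A ⟶ B)} {j : A ⟶ B} (h : IsLUB s j) : lub s = j := by
  have h' : ∃ j, IsLUB s j := ⟨j, h⟩
  rw [lub, dif_pos h']
  exact h'.choose_spec.unique h

end Order

/-! ### Interference relations, disjoint joins, Kleene wands -/

/-- An interference relation on a restriction category with restriction zeroes. -/
structure Interference (C : Type u) [Category.{v} C] [RestrictionCategory C]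
    [RestrictionZeroes C] where
  perp : ∀ {A B B' : C}, (A ⟶ B) → (A ⟶ B') → Prop
  one_perp_zero : ∀ A B : C, perp (𝟙 A) (0 : A ⟶ B)
  symm : ∀ {A B B' : C} {f : A ⟶ B} {g : A ⟶ B'}, perp f g → perp g f
  eq_zero : ∀ {A B : C} {f : A ⟶ B}, perp f f → f = 0
  mono : ∀ {A B B' : C} {f f' : A ⟶ B} {g g' : A ⟶ B'},
    perp f' g' → f ≤ f' → g ≤ g' → perp f g
  comp : ∀ {A' A B B' D D' : C} {f : A ⟶ B} {g : A ⟶ B'} (h : A' ⟶ A) (k : B ⟶ D)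
    (k' : B' ⟶ D'), perp f g → perp (h ≫ f ≫ k) (h ≫ g ≫ k')
  rest : ∀ {A B B' : C} {f : A ⟶ B} {g : A ⟶ B'}, perp f g → perp (rest f) (rest g)

namespace Interference

variable {C : Type u} [Category.{v} C] [RestrictionCategory C] [RestrictionZeroes C]
  (P : Interference C)

/-- All binary disjoint joins exist and are preserved by pre-composition. -/
def HasBinaryJoins : Prop :=
  ∀ {A B : C} (f g : A ⟶ B), P.perp f g →
    ∃ j : A ⟶ B, IsLUB {f, g} j ∧
      ∀ {A' : C} (h : A' ⟶ A), IsLUB {h ≫ f, h ≫ g} (h ≫ j)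

/-- A family of maps out of `A` is disjoint if its members are pairwise disjoint. -/
def Disj {A : C} {ι : Type} {B : ι → C} (f : ∀ i, A ⟶ B i) : Prop :=
  ∀ i j, i ≠ j → P.perp (f i) (f j)

/-- Finitely disjoint: all joins of finite disjoint families of parallel maps exist, they are
preserved by pre-composition, and they are strong. -/
structure FinitelyDisjoint : Prop where
  exists_join : ∀ {A B : C} {ι : Type} [Finite ι] (f : ι → (A ⟶ B)), P.Disj f →
    ∃ j : A ⟶ B, IsLUB (Set.range f) j
  stable : ∀ {A B : C} {ι : Type} [Finite ι] (f : ι → (A ⟶ B)), P.Disj f →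
    ∀ j : A ⟶ B, IsLUB (Set.range f) j →
      ∀ {A' : C} (h : A' ⟶ A), IsLUB (Set.range fun i => h ≫ f i) (h ≫ j)
  strong : ∀ {A B : C} {ι : Type} [Finite ι] (f : ι → (A ⟶ B)), P.Disj f →
    ∀ j : A ⟶ B, IsLUB (Set.range f) j →
      ∀ {D : C} (h : A ⟶ D), (∀ i, P.perp (f i) h) → P.perp j h

theorem perp_comp_right {A B B' D D' : C} {f : A ⟶ B} {g : A ⟶ B'} (h : P.perp f g)
    (k : B ⟶ D) (k' : B' ⟶ D') : P.perp (f ≫ k) (g ≫ k') := by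
  simpa using P.comp (𝟙 A) k k' h

theorem perp_comp_left {A' A B B' : C} {f : A ⟶ B} {g : A ⟶ B'} (h : P.perp f g)
    (k : A' ⟶ A) : P.perp (k ≫ f) (k ≫ g) := by
  simpa using P.comp k (𝟙 _) (𝟙 _) h

theorem perp_zero {A B B' : C} (f : A ⟶ B) : P.perp f (0 : A ⟶ B') := by
  simpa using P.perp_comp_right (P.one_perp_zero A B') f (𝟙 _)

theorem rest_comp_rest_eq_zero {A B B' : C} {f : A ⟶ B} {g : A ⟶ B'} (h : P.perp f g) :
    RestrictionCategory.rest f ≫ RestrictionCategory.rest g = 0 := by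
  have h1 := P.perp_comp_left (P.rest h)
    (RestrictionCategory.rest f ≫ RestrictionCategory.rest g)
  rw [Category.assoc, Category.assoc, rest_idem, rest_comm g f, ← Category.assoc, rest_idem] at h1
  exact P.eq_zero h1

theorem rest_comp_eq_zero {A B B' : C} {f : A ⟶ B} {g : A ⟶ B'} (h : P.perp f g) :
    RestrictionCategory.rest f ≫ g = 0 := by
  rw [← rest_comp_self g, ← Category.assoc, P.rest_comp_rest_eq_zero h, zero_comp]

/-- A Kleene wand for the interference relation `P` (meant for relations that have all binary
disjoint joins; `IsLUB {f, f'} j` says that `j` is the join of `f` and `f'`). -/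
structure KleeneWand where
  wand : ∀ {X A : C} (f : X ⟶ X) (g : X ⟶ A), P.perp f g → (X ⟶ A)
  iteration : ∀ {X A : C} (f : X ⟶ X) (g : X ⟶ A) (h : P.perp f g),
    IsLUB {g, f ≫ wand f g h} (wand f g h)
  naturality : ∀ {X A B : C} (f : X ⟶ X) (g : X ⟶ A) (k : A ⟶ B) (h : P.perp f g)
    (h' : P.perp f (g ≫ k)), wand f g h ≫ k = wand f (g ≫ k) h'
  dinaturality : ∀ {X Y A : C} (f : X ⟶ Y) (g : X ⟶ A) (k : Y ⟶ X), P.perp f g →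
    ∀ (h : P.perp (k ≫ f) (k ≫ g)) (h' : P.perp (f ≫ k) g),
      wand (k ≫ f) (k ≫ g) h = k ≫ wand (f ≫ k) g h'
  diagonal : ∀ {X A : C} (f f' : X ⟶ X) (g : X ⟶ A) (h : P.perp f f') (j : X ⟶ X),
    IsLUB {f, f'} j → ∀ (hj : P.perp j g) (hg : P.perp f g),
      ∃ h' : P.perp (wand f f' h) (wand f g hg),
        wand j g hj = wand (wand f f' h) (wand f g hg) h'

section Joins

variable {P}

theorem FinitelyDisjoint.isLUB (hP : P.FinitelyDisjoint) {A B : C} {ι : Type} [Finite ι]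
    {f : ι → (A ⟶ B)} (hf : P.Disj f) : IsLUB (Set.range f) (lub (Set.range f)) := by
  obtain ⟨j, hj⟩ := hP.exists_join f hf
  rwa [lub_eq hj]

theorem FinitelyDisjoint.lub_le_iff (hP : P.FinitelyDisjoint) {A B : C} {ι : Type} [Finite ι]
    {f : ι → (A ⟶ B)} (hf : P.Disj f) (x : A ⟶ B) :
    lub (Set.range f) ≤ x ↔ ∀ i, f i ≤ x := by
  rw [isLUB_le_iff (hP.isLUB hf)]
  simp [upperBounds]

theorem FinitelyDisjoint.le_lub (hP : P.FinitelyDisjoint) {A B : C} {ι : Type} [Finite ι]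
    {f : ι → (A ⟶ B)} (hf : P.Disj f) (i : ι) : f i ≤ lub (Set.range f) :=
  (hP.isLUB hf).1 ⟨i, rfl⟩

theorem lub_single {A B : C} {ι : Type} (f : ι → (A ⟶ B)) (i : ι)
    (h : ∀ j, j ≠ i → f j = 0) : lub (Set.range f) = f i := by
  apply lub_eq
  constructor
  · rintro _ ⟨j, rfl⟩
    by_cases hj : j = i
    · rw [hj]
    · simp only [h j hj]
      exact zero_le' _
  · intro x hx
    exact hx ⟨i, rfl⟩

theorem lub_zero {A B : C} {ι : Type} (f : ι → (A ⟶ B)) (h : ∀ j, f j = 0) :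
    lub (Set.range f) = 0 := by
  apply lub_eq
  constructor
  · rintro _ ⟨j, rfl⟩
    simp only [h j]
    exact le_refl _
  · intro x _
    exact zero_le' _

theorem Disj.comp_left {A' A : C} {ι : Type} {B : ι → C} {f : ∀ i, A ⟶ B i} (hf : P.Disj f)
    (h : A' ⟶ A) : P.Disj fun i => h ≫ f i :=
  fun i j hij => P.perp_comp_left (hf i j hij) h

theorem Disj.comp_right {A : C} {ι : Type} {B D : ι → C} {f : ∀ i, A ⟶ B i} (hf : P.Disj f)
    (k : ∀ i, B i ⟶ D i) : P.Disj fun i => f i ≫ k i :=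
  fun i j hij => P.perp_comp_right (hf i j hij) (k i) (k j)

theorem Disj.rest {A : C} {ι : Type} {B : ι → C} {f : ∀ i, A ⟶ B i} (hf : P.Disj f) :
    P.Disj fun i => RestrictionCategory.rest (f i) :=
  fun i j hij => P.rest (hf i j hij)

theorem FinitelyDisjoint.comp_lub (hP : P.FinitelyDisjoint) {A' A B : C} {ι : Type} [Finite ι]
    {f : ι → (A ⟶ B)} (hf : P.Disj f) (h : A' ⟶ A) :
    h ≫ lub (Set.range f) = lub (Set.range fun i => h ≫ f i) :=
  (lub_eq (hP.stable f hf _ (hP.isLUB hf) h)).symm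

theorem FinitelyDisjoint.rest_lub (hP : P.FinitelyDisjoint) {A B : C} {ι : Type} [Finite ι]
    {f : ι → (A ⟶ B)} (hf : P.Disj f) :
    RestrictionCategory.rest (lub (Set.range f)) =
      lub (Set.range fun i => RestrictionCategory.rest (f i)) := by
  set j := lub (Set.range f) with hj
  set r := lub (Set.range fun i => RestrictionCategory.rest (f i)) with hr
  have hr1 : r ≤ 𝟙 A := (hP.lub_le_iff hf.rest _).2 fun i => rest_le_one _
  apply le_antisymm
  · have hjr : j ≤ r ≫ j := by
      rw [hj, hP.lub_le_iff hf]
      intro i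
      have h1 : RestrictionCategory.rest (f i) ≫ j ≤ r ≫ j :=
        comp_mono (hP.le_lub hf.rest i) le_rfl
      rwa [(le_def _ _).1 (hP.le_lub hf i)] at h1
    have h2 : r ≫ j = j := by
      apply le_antisymm _ hjr
      simpa using comp_mono hr1 (le_refl j)
    have h3 : RestrictionCategory.rest j = r ≫ RestrictionCategory.rest j := by
      conv_lhs => rw [← h2, ← rest_of_le_one hr1, rest_rest_comp, rest_of_le_one hr1]
    rw [h3]
    simpa using comp_mono (le_refl r) (rest_le_one j)
  · rw [hr, hP.lub_le_iff hf.rest]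
    exact fun i => rest_mono (hP.le_lub hf i)

theorem FinitelyDisjoint.lub_comp (hP : P.FinitelyDisjoint) {A B D : C} {ι : Type} [Finite ι]
    {f : ι → (A ⟶ B)} (hf : P.Disj f) (k : B ⟶ D) :
    lub (Set.range f) ≫ k = lub (Set.range fun i => f i ≫ k) := by
  have hfk : P.Disj fun i => f i ≫ k := hf.comp_right fun _ => k
  set j := lub (Set.range f) with hj
  set m := lub (Set.range fun i => f i ≫ k) with hm
  have hmj : m ≤ j ≫ k := by
    rw [hm, hP.lub_le_iff hfk]
    exact fun i => comp_mono (hP.le_lub hf i) le_rfl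
  have h1 : RestrictionCategory.rest (j ≫ k) ≤ RestrictionCategory.rest m := by
    rw [← rest_comp_rest j k, rest_comm, hj, hP.rest_lub hf, hP.comp_lub hf.rest,
      hP.lub_le_iff (hf.rest.comp_left _)]
    intro i
    have h2 : RestrictionCategory.rest (f i) ≫ (j ≫ k) = f i ≫ k := by
      rw [← Category.assoc, (le_def _ _).1 (hP.le_lub hf i)]
    rw [← hj, rest_comm, ← rest_rest_comp, h2]
    exact rest_mono (hP.le_lub hfk i)
  have h3 : RestrictionCategory.rest (j ≫ k) = RestrictionCategory.rest m :=
    le_antisymm h1 (rest_mono hmj)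
  rw [le_def, ← h3, rest_comp_self] at hmj
  exact hmj

theorem FinitelyDisjoint.perp_lub (hP : P.FinitelyDisjoint) {A B B' : C} {ι κ : Type} [Finite ι]
    [Finite κ] {f : ι → (A ⟶ B)} {g : κ → (A ⟶ B')} (hf : P.Disj f) (hg : P.Disj g)
    (h : ∀ i k, P.perp (f i) (g k)) : P.perp (lub (Set.range f)) (lub (Set.range g)) := by
  apply hP.strong f hf _ (hP.isLUB hf)
  intro i
  apply P.symm
  apply hP.strong g hg _ (hP.isLUB hg)
  exact fun k => P.symm (h i k)

end Joins

end Interference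

/-! ### Coproducts, extensivity, decisions, traces -/

/-- An extensive restriction category: a restriction category with restriction zeroes, with finite
coproducts whose injections are total, and such that every map into a finite coproduct has a
decision. -/
class IsExtensive (C : Type u) [Category.{v} C] [RestrictionCategory C]
    [RestrictionZeroes C] : Prop extends HasFiniteCoproducts C where
  total_injection : ∀ {n : ℕ} (B : Fin n → C) (i : Fin n), IsTotal (Limits.Sigma.ι B i)
  decision : ∀ {n : ℕ} {A : C} {B : Fin n → C} (f : A ⟶ ∐ B),
    ∃ d : A ⟶ ∐ fun _ : Fin n => A,
      rest f = d ≫ Limits.Sigma.desc (fun _ => 𝟙 A) ∧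
      d ≫ Limits.Sigma.map (fun _ => f) = f ≫ Limits.Sigma.map (fun i => Limits.Sigma.ι B i)

/-- A choice of binary coproducts. -/
class ChosenCoproducts (C : Type u) [Category.{v} C] where
  cofan : ∀ X Y : C, BinaryCofan X Y
  isColimit : ∀ X Y : C, IsColimit (cofan X Y)

section Coproducts

variable {C : Type u} [Category.{v} C] [ChosenCoproducts C]

/-- the chosen coproduct `X + Y` -/
def plus (X Y : C) : C := (ChosenCoproducts.cofan X Y).pt

/-- the first injection `X ⟶ X + Y` -/
def inl (X Y : C) : X ⟶ plus X Y := (ChosenCoproducts.cofan X Y).inl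

/-- the second injection `Y ⟶ X + Y` -/
def inr (X Y : C) : Y ⟶ plus X Y := (ChosenCoproducts.cofan X Y).inr

/-- the copairing of two maps -/
def copair {X Y Z : C} (f : X ⟶ Z) (g : Y ⟶ Z) : plus X Y ⟶ Z :=
  (ChosenCoproducts.isColimit X Y).desc (BinaryCofan.mk f g)

/-- the coproduct `f + g` of two maps -/
def sumMap {X X' Y Y' : C} (f : X ⟶ X') (g : Y ⟶ Y') : plus X Y ⟶ plus X' Y' :=
  copair (f ≫ inl X' Y') (g ≫ inr X' Y')

/-- the symmetry `X + X ⟶ X + X` -/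
def swap (X : C) : plus X X ⟶ plus X X := copair (inr X X) (inl X X)

/-- the associativity isomorphism `(X + Y) + Z ⟶ X + (Y + Z)` -/
def assocHom (X Y Z : C) : plus (plus X Y) Z ⟶ plus X (plus Y Z) :=
  copair (copair (inl X (plus Y Z)) (inl Y Z ≫ inr X (plus Y Z))) (inr Y Z ≫ inr X (plus Y Z))

/-- the inverse associativity isomorphism `X + (Y + Z) ⟶ (X + Y) + Z` -/
def assocInv (X Y Z : C) : plus X (plus Y Z) ⟶ plus (plus X Y) Z :=
  copair (inl X Y ≫ inl (plus X Y) Z) (copair (inr X Y ≫ inl (plus X Y) Z) (inr (plus X Y) Z))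

/-- the first quasi-projection `X + Y ⟶ X` -/
def quasiFst [HasZeroMorphisms C] (X Y : C) : plus X Y ⟶ X := copair (𝟙 X) 0

/-- the second quasi-projection `X + Y ⟶ Y` -/
def quasiSnd [HasZeroMorphisms C] (X Y : C) : plus X Y ⟶ Y := copair 0 (𝟙 Y)

/-- A binary decision. -/
def IsDecision [RestrictionCategory C] {A : C} (d : A ⟶ plus A A) : Prop :=
  rest d = d ≫ copair (𝟙 A) (𝟙 A) ∧ d ≫ sumMap d d = d ≫ sumMap (inl A A) (inr A A)

/-- Decision disjointness: `f` and `g` have a separating decision. -/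
def DecisionDisjoint [RestrictionCategory C] [RestrictionZeroes C] {A B B' : C}
    (f : A ⟶ B) (g : A ⟶ B') : Prop :=
  ∃ d : A ⟶ plus A A, IsDecision d ∧ d ≫ quasiFst A A = rest f ∧ d ≫ quasiSnd A A = rest g

variable (C) in
/-- A trace operator for the (chosen) binary coproducts; the associativity isomorphisms, which are
left implicit in the strict notation, are inserted in the vanishing and superposing axioms. -/
structure TraceOperator where
  tr : ∀ {X A B : C}, (plus X A ⟶ plus X B) → (A ⟶ B)
  tightening : ∀ {X A A' B B' : C} (f : plus X A ⟶ plus X B) (g : A' ⟶ A) (h : B ⟶ B'),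
    tr (sumMap (𝟙 X) g ≫ f ≫ sumMap (𝟙 X) h) = g ≫ tr f ≫ h
  sliding : ∀ {X X' A B : C} (f : plus X A ⟶ plus X' B) (k : X' ⟶ X),
    tr (f ≫ sumMap k (𝟙 B)) = tr (sumMap k (𝟙 A) ≫ f)
  vanishing : ∀ {X Y A B : C} (f : plus (plus X Y) A ⟶ plus (plus X Y) B),
    tr f = tr (tr (assocInv X Y A ≫ f ≫ assocHom X Y B))
  superposing : ∀ {X A B D E : C} (f : plus X A ⟶ plus X B) (g : D ⟶ E),
    tr (assocInv X A D ≫ sumMap f g ≫ assocHom X B E) = sumMap (tr f) g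
  yanking : ∀ X : C, tr (swap X) = 𝟙 X

end Coproducts

/-! ### The matrix construction -/

section Matrix

variable {C : Type u} [Category.{v} C] [RestrictionCategory C] [RestrictionZeroes C]

/-- Objects of the matrix category: finite (possibly empty) lists of objects of `C`. -/
structure MAT (P : Interference C) (hP : P.FinitelyDisjoint) where
  len : ℕ
  obj : Fin len → C

namespace MAT

variable {P : Interference C} {hP : P.FinitelyDisjoint}

/-- Maps of the matrix category: matrices of maps with disjoint rows. -/
@[ext] structure Hom (A B : MAT P hP) where
  val : ∀ (i : Fin A.len) (j : Fin B.len), A.obj i ⟶ B.obj j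
  disj : ∀ i, P.Disj (val i)

/-- The diagonal matrix of a family of endomaps. -/
def diag (A : MAT P hP) (e : ∀ i, A.obj i ⟶ A.obj i) : Hom A A where
  val i j := if h : i = j then e i ≫ eqToHom (congrArg A.obj h) else 0
  disj i := by
    intro j k hjk
    beta_reduce
    by_cases hj : i = j
    · rw [dif_neg (fun h : i = k => hjk (hj.symm.trans h))]
      exact P.perp_zero _
    · rw [dif_neg hj]
      exact P.symm (P.perp_zero _)

theorem disj_comp {A B D : MAT P hP} (F : Hom A B) (G : Hom B D) (i : Fin A.len)
    (k : Fin D.len) : P.Disj fun j => F.val i j ≫ G.val j k :=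
  (F.disj i).comp_right fun j => G.val j k

/-- Matrix multiplication, with disjoint joins as sums. -/
noncomputable def mul {A B D : MAT P hP} (F : Hom A B) (G : Hom B D) : Hom A D where
  val i k := lub (Set.range fun j => F.val i j ≫ G.val j k)
  disj i := by
    intro k k' hk
    refine hP.perp_lub (disj_comp F G i k) (disj_comp F G i k') fun j j' => ?_
    by_cases hj : j = j'
    · subst hj
      exact P.perp_comp_left (G.disj j k k' hk) _
    · exact P.perp_comp_right (F.disj i j j' hj) _ _

theorem diag_mul {A B : MAT P hP} (e : ∀ i, A.obj i ⟶ A.obj i) (F : Hom A B) (i : Fin A.len)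
    (k : Fin B.len) : (mul (diag A e) F).val i k = e i ≫ F.val i k := by
  change lub (Set.range fun j => (diag A e).val i j ≫ F.val j k) = _
  rw [Interference.lub_single _ i]
  · simp [diag]
  · intro j hj
    simp [diag, Ne.symm hj]

theorem mul_diag {A B : MAT P hP} (e : ∀ i, B.obj i ⟶ B.obj i) (F : Hom A B) (i : Fin A.len)
    (k : Fin B.len) : (mul F (diag B e)).val i k = F.val i k ≫ e k := by
  change lub (Set.range fun j => F.val i j ≫ (diag B e).val j k) = _
  rw [Interference.lub_single _ k]
  · simp [diag]
  · intro j hj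
    simp [diag, hj]

theorem mul_assoc' {A B D E : MAT P hP} (F : Hom A B) (G : Hom B D) (H : Hom D E) :
    mul (mul F G) H = mul F (mul G H) := by
  ext i l
  apply eq_of_forall_ge_iff
  intro x
  change lub (Set.range fun k => (mul F G).val i k ≫ H.val k l) ≤ x ↔
    lub (Set.range fun j => F.val i j ≫ (mul G H).val j l) ≤ x
  rw [hP.lub_le_iff (disj_comp (mul F G) H i l), hP.lub_le_iff (disj_comp F (mul G H) i l)]
  have h1 : ∀ k, (mul F G).val i k ≫ H.val k l ≤ x ↔
      ∀ j, (F.val i j ≫ G.val j k) ≫ H.val k l ≤ x := by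
    intro k
    change lub (Set.range fun j => F.val i j ≫ G.val j k) ≫ H.val k l ≤ x ↔ _
    rw [hP.lub_comp (disj_comp F G i k),
      hP.lub_le_iff ((disj_comp F G i k).comp_right fun _ => H.val k l)]
  have h2 : ∀ j, F.val i j ≫ (mul G H).val j l ≤ x ↔
      ∀ k, F.val i j ≫ G.val j k ≫ H.val k l ≤ x := by
    intro j
    change F.val i j ≫ lub (Set.range fun k => G.val j k ≫ H.val k l) ≤ x ↔ _
    rw [hP.comp_lub (disj_comp G H j l),
      hP.lub_le_iff ((disj_comp G H j l).comp_left (F.val i j))]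
  simp only [h1, h2, Category.assoc]
  exact forall_comm

noncomputable instance : Category (MAT P hP) where
  Hom := Hom
  id A := diag A fun i => 𝟙 (A.obj i)
  comp F G := mul F G
  id_comp F := by
    ext i k
    rw [diag_mul, Category.id_comp]
  comp_id F := by
    ext i k
    rw [mul_diag, Category.comp_id]
  assoc F G H := mul_assoc' F G H

@[ext] theorem hom_ext {A B : MAT P hP} {F G : A ⟶ B} (h : ∀ i j, F.val i j = G.val i j) :
    F = G := Hom.ext (funext fun i => funext fun j => h i j)

theorem comp_val {A B D : MAT P hP} (F : A ⟶ B) (G : B ⟶ D) (i : Fin A.len) (k : Fin D.len) :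
    (F ≫ G).val i k = lub (Set.range fun j => F.val i j ≫ G.val j k) := rfl

/-- The `i`-th diagonal entry of the restriction of a matrix: the join of the restrictions of the
entries of the `i`-th row. -/
noncomputable def rowRest {A B : MAT P hP} (F : A ⟶ B) (i : Fin A.len) : A.obj i ⟶ A.obj i :=
  lub (Set.range fun j => rest (F.val i j))

theorem rowRest_le_one {A B : MAT P hP} (F : A ⟶ B) (i : Fin A.len) : rowRest F i ≤ 𝟙 _ :=
  (hP.lub_le_iff (F.disj i).rest _).2 fun _ => rest_le_one _

theorem rest_rowRest {A B : MAT P hP} (F : A ⟶ B) (i : Fin A.len) :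
    rest (rowRest F i) = rowRest F i := rest_of_le_one (rowRest_le_one F i)

noncomputable instance : RestrictionCategory (MAT P hP) where
  rest {A B} F := diag A (rowRest F)
  rest_comp_self {A B} F := by
    ext i k
    refine (diag_mul (rowRest F) F i k).trans ?_
    rw [rowRest, hP.lub_comp (F.disj i).rest, Interference.lub_single _ k, rest_comp_self]
    exact fun j hj => P.rest_comp_eq_zero (F.disj i j k hj)
  rest_comm {A B B'} F G := by
    ext i k
    refine (diag_mul _ _ i k).trans (Eq.trans ?_ (diag_mul _ _ i k).symm)
    by_cases h : i = k
    · subst h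
      simp only [diag, dite_true, eqToHom_refl, Category.comp_id]
      rw [← rest_rowRest F, ← rest_rowRest G, rest_comm]
    · simp [diag, h]
  rest_rest_comp {A B B'} F G := by
    have h : rowRest (mul (diag A (rowRest G)) F) = fun i => rowRest G i ≫ rowRest F i := by
      funext i
      rw [rowRest]
      simp only [diag_mul]
      have h1 : ∀ j, rest (rowRest G i ≫ F.val i j) = rowRest G i ≫ rest (F.val i j) := by
        intro j
        conv_lhs => rw [← rest_rowRest G i, rest_rest_comp, rest_rowRest]
      simp only [h1]
      rw [← hP.comp_lub (F.disj i).rest, ← rowRest]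
    ext i k
    refine Eq.trans ?_ (diag_mul _ _ i k).symm
    change (diag A (rowRest (mul (diag A (rowRest G)) F))).val i k = _
    rw [h]
    by_cases h : i = k
    · subst h
      simp [diag]
    · simp [diag, h]
  comp_rest {A B D} F G := by
    ext i k
    refine (mul_diag _ _ i k).trans (Eq.trans ?_ (diag_mul _ _ i k).symm)
    have h1 : ∀ l, rest ((mul F G).val i l) ≫ F.val i k =
        rest (F.val i k ≫ G.val k l) ≫ F.val i k := by
      intro l
      change rest (lub (Set.range fun j => F.val i j ≫ G.val j l)) ≫ F.val i k = _
      rw [hP.rest_lub (disj_comp F G i l), hP.lub_comp (disj_comp F G i l).rest,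
        Interference.lub_single _ k]
      intro j hj
      rw [← rest_comp_rest, rest_comm, Category.assoc, P.rest_comp_eq_zero (F.disj i j k hj),
        comp_zero]
    have h2 : rowRest (mul F G) i ≫ F.val i k =
        lub (Set.range fun l => rest (F.val i k ≫ G.val k l) ≫ F.val i k) := by
      rw [rowRest, hP.lub_comp ((mul F G).disj i).rest]
      simp only [h1]
    refine Eq.trans ?_ h2.symm
    rw [rowRest, hP.comp_lub (G.disj k).rest]
    simp only [comp_rest]

/-- the zero matrix -/
def zeroHom (A B : MAT P hP) : A ⟶ B where
  val _ _ := 0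
  disj _ _ _ _ := P.perp_zero _

noncomputable instance : RestrictionZeroes (MAT P hP) where
  zero A B := ⟨zeroHom A B⟩
  comp_zero F D := by
    ext i k
    exact Interference.lub_zero _ fun j => comp_zero
  zero_comp A B D F := by
    ext i k
    exact Interference.lub_zero _ fun j => zero_comp
  rest_zero A B := by
    ext i k
    change (diag A (rowRest (zeroHom A B))).val i k = 0
    have h : rowRest (zeroHom A B) i = 0 :=
      Interference.lub_zero _ fun j => RestrictionZeroes.rest_zero _ _
    simp [diag, h]

/-- Concatenation of lists. -/
def append (A B : MAT P hP) : MAT P hP := ⟨A.len + B.len, Fin.append A.obj B.obj⟩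

/-- The position in the concatenation of `A` and `B` of the `i`-th entry of `A`. -/
def posLeft (A B : MAT P hP) (i : Fin A.len) : Fin (append A B).len := Fin.castAdd B.len i

/-- The position in the concatenation of `A` and `B` of the `i`-th entry of `B`. -/
def posRight (A B : MAT P hP) (i : Fin B.len) : Fin (append A B).len := Fin.natAdd A.len i

/-- The entry of `A` at `i` is the entry of the concatenation of `A` and `B` at position `i`. -/
theorem append_obj_left (A B : MAT P hP) (i : Fin A.len) :
    A.obj i = (append A B).obj (posLeft A B i) :=
  (Fin.append_left A.obj B.obj i).symm

/-- The entry of `B` at `i` is the entry of the concatenation of `A` and `B` at position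
`A.len + i`. -/
theorem append_obj_right (A B : MAT P hP) (i : Fin B.len) :
    B.obj i = (append A B).obj (posRight A B i) :=
  (Fin.append_right A.obj B.obj i).symm

/-- The first injection matrix. -/
def injLeft (A B : MAT P hP) : A ⟶ append A B where
  val i k := if h : posLeft A B i = k then
    eqToHom ((append_obj_left A B i).trans (congrArg (append A B).obj h)) else 0
  disj i := by
    intro j k hjk
    beta_reduce
    by_cases hj : posLeft A B i = j
    · rw [dif_neg (fun h : posLeft A B i = k => hjk (hj.symm.trans h))]
      exact P.perp_zero _
    · rw [dif_neg hj]
      exact P.symm (P.perp_zero _)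

/-- The second injection matrix. -/
def injRight (A B : MAT P hP) : B ⟶ append A B where
  val i k := if h : posRight A B i = k then
    eqToHom ((append_obj_right A B i).trans (congrArg (append A B).obj h)) else 0
  disj i := by
    intro j k hjk
    beta_reduce
    by_cases hj : posRight A B i = j
    · rw [dif_neg (fun h : posRight A B i = k => hjk (hj.symm.trans h))]
      exact P.perp_zero _
    · rw [dif_neg hj]
      exact P.symm (P.perp_zero _)

theorem injLeft_comp {A B D : MAT P hP} (F : append A B ⟶ D) (i : Fin A.len) (k : Fin D.len) :
    (injLeft A B ≫ F).val i k =
      eqToHom (append_obj_left A B i) ≫ F.val (posLeft A B i) k := by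
  rw [comp_val, Interference.lub_single _ (posLeft A B i)]
  · simp [injLeft]
  · intro j hj
    simp [injLeft, Ne.symm hj]

theorem injRight_comp {A B D : MAT P hP} (F : append A B ⟶ D) (i : Fin B.len) (k : Fin D.len) :
    (injRight A B ≫ F).val i k =
      eqToHom (append_obj_right A B i) ≫ F.val (posRight A B i) k := by
  rw [comp_val, Interference.lub_single _ (posRight A B i)]
  · simp [injRight]
  · intro j hj
    simp [injRight, Ne.symm hj]

/-- The matrix obtained by stacking the rows of `F` on those of `G`. -/
def stack {A B D : MAT P hP} (F : A ⟶ D) (G : B ⟶ D) : append A B ⟶ D where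
  val i k := Fin.addCases (motive := fun i => (append A B).obj i ⟶ D.obj k)
    (fun a => eqToHom (append_obj_left A B a).symm ≫ F.val a k)
    (fun b => eqToHom (append_obj_right A B b).symm ≫ G.val b k) i
  disj i := by
    intro j k hjk
    refine Fin.addCases (fun a => ?_) (fun b => ?_) i
    · simp only [Fin.addCases_left]
      exact P.perp_comp_left (F.disj a j k hjk) _
    · simp only [Fin.addCases_right]
      exact P.perp_comp_left (G.disj b j k hjk) _

theorem stack_left {A B D : MAT P hP} (F : A ⟶ D) (G : B ⟶ D) (a : Fin A.len) (k : Fin D.len) :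
    (stack F G).val (posLeft A B a) k = eqToHom (append_obj_left A B a).symm ≫ F.val a k := by
  simp [stack, posLeft]

theorem stack_right {A B D : MAT P hP} (F : A ⟶ D) (G : B ⟶ D) (b : Fin B.len) (k : Fin D.len) :
    (stack F G).val (posRight A B b) k = eqToHom (append_obj_right A B b).symm ≫ G.val b k := by
  simp [stack, posRight]

theorem eqToHom_cancel {E : Type u} [Category.{v} E] {X Y Z : E} (h : X = Y) (h' : Y = X) (f : X ⟶ Z) :
    eqToHom h ≫ eqToHom h' ≫ f = f := by
  subst h
  simp

theorem injLeft_stack {A B D : MAT P hP} (F : A ⟶ D) (G : B ⟶ D) :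
    injLeft A B ≫ stack F G = F := by
  ext i k
  rw [injLeft_comp, stack_left]
  exact eqToHom_cancel _ _ _

theorem injRight_stack {A B D : MAT P hP} (F : A ⟶ D) (G : B ⟶ D) :
    injRight A B ≫ stack F G = G := by
  ext i k
  rw [injRight_comp, stack_right]
  exact eqToHom_cancel _ _ _

theorem eq_stack {A B D : MAT P hP} (H : append A B ⟶ D) :
    H = stack (injLeft A B ≫ H) (injRight A B ≫ H) := by
  ext i k
  refine Fin.addCases (fun a => ?_) (fun b => ?_) i
  · refine Eq.trans ?_ (stack_left (injLeft A B ≫ H) (injRight A B ≫ H) a k).symm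
    rw [injLeft_comp]
    exact (eqToHom_cancel _ _ _).symm
  · refine Eq.trans ?_ (stack_right (injLeft A B ≫ H) (injRight A B ≫ H) b k).symm
    rw [injRight_comp]
    exact (eqToHom_cancel _ _ _).symm

/-- Concatenation of lists is a coproduct. -/
noncomputable instance : ChosenCoproducts (MAT P hP) where
  cofan A B := BinaryCofan.mk (injLeft A B) (injRight A B)
  isColimit A B := BinaryCofan.isColimitMk (fun s => stack s.inl s.inr)
    (fun s => injLeft_stack s.inl s.inr)
    (fun s => injRight_stack s.inl s.inr)
    (fun s m h1 h2 => by rw [← h1, ← h2]; exact eq_stack m)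

/-- The embedding of `C` as one-element lists and one-by-one matrices. -/
noncomputable def embed (P : Interference C) (hP : P.FinitelyDisjoint) : C ⥤ MAT P hP where
  obj A := ⟨1, fun _ => A⟩
  map f :=
    { val := fun _ _ => f
      disj := fun _ i j hij => absurd (Subsingleton.elim i j) hij }
  map_id A := by
    apply hom_ext
    intro (i : Fin 1) (j : Fin 1)
    obtain rfl := Subsingleton.elim i j
    change 𝟙 A = (diag ⟨1, fun _ => A⟩ fun _ => 𝟙 A : Hom (hP := hP) _ _).val i i
    simp [diag]
  map_comp f g := by
    apply hom_ext
    intro (i : Fin 1) (j : Fin 1)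
    rw [comp_val]
    exact (Interference.lub_single (fun _ : Fin 1 => f ≫ g) 0
      fun j hj => absurd (Subsingleton.elim j 0) hj).symm

/-! The entries of the four blocks of a matrix `F : X + A ⟶ Y + B`. -/

section Blocks

variable {X A Y B : MAT P hP} (F : plus X A ⟶ plus Y B)

/-- entries of the upper left block `X ⟶ Y` -/
noncomputable def block11 (i : Fin X.len) (j : Fin Y.len) : X.obj i ⟶ Y.obj j :=
  eqToHom (append_obj_left X A i) ≫ F.val (posLeft X A i) (posLeft Y B j) ≫
    eqToHom (append_obj_left Y B j).symm

/-- entries of the upper right block `X ⟶ B` -/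
noncomputable def block12 (i : Fin X.len) (j : Fin B.len) : X.obj i ⟶ B.obj j :=
  eqToHom (append_obj_left X A i) ≫ F.val (posLeft X A i) (posRight Y B j) ≫
    eqToHom (append_obj_right Y B j).symm

/-- entries of the lower left block `A ⟶ Y` -/
noncomputable def block21 (i : Fin A.len) (j : Fin Y.len) : A.obj i ⟶ Y.obj j :=
  eqToHom (append_obj_right X A i) ≫ F.val (posRight X A i) (posLeft Y B j) ≫
    eqToHom (append_obj_left Y B j).symm

/-- entries of the lower right block `A ⟶ B` -/
noncomputable def block22 (i : Fin A.len) (j : Fin B.len) : A.obj i ⟶ B.obj j :=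
  eqToHom (append_obj_right X A i) ≫ F.val (posRight X A i) (posRight Y B j) ≫
    eqToHom (append_obj_right Y B j).symm

theorem block11_perp_block12 (i : Fin X.len) (j : Fin Y.len) (k : Fin B.len) :
    P.perp (block11 F i j) (block12 F i k) := by
  refine P.comp _ _ _ (F.disj _ _ _ ?_)
  intro h
  have h' := congrArg Fin.val h
  simp only [posLeft, posRight, Fin.val_castAdd, Fin.val_natAdd] at h'
  have := j.isLt
  omega

end Blocks

end MAT

/-! ### The inductive trace formula for matrices -/

open Classical in
/-- `k ⊔ h (f ⩘ g)`, the trace of the two-by-two matrix with rows `(f, g)` and `(h, k)`, which is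
meaningful if the rows are disjoint. -/
noncomputable def trace₂ {P : Interference C} (W : P.KleeneWand) {X A B : C}
    (f : X ⟶ X) (g : X ⟶ B) (h : A ⟶ X) (k : A ⟶ B) : A ⟶ B :=
  if hfg : P.perp f g then lub {k, h ≫ W.wand f g hfg} else 0

/-- The trace of the matrix with blocks `S`, `U` (rows `X₁, …, Xₙ`) and `W`, `k` (row `A`) along
`X₁, …, Xₙ`: nothing is traced out if `n = 0`, and the trace along `X₁, …, Xₙ₊₁` is the trace along
`Xₙ₊₁` of the two-by-two matrix of the traces along `X₁, …, Xₙ`. -/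
noncomputable def traceEntry {P : Interference C} (Wd : P.KleeneWand) :
    ∀ (n : ℕ) (X : Fin n → C) {A B : C} (_ : ∀ i j, X i ⟶ X j) (_ : ∀ i, X i ⟶ B)
      (_ : ∀ j, A ⟶ X j) (_ : A ⟶ B), (A ⟶ B)
  | 0, _, _, _, _, _, _, k => k
  | n + 1, X, _, _, S, U, W, k =>
    let X' : Fin n → C := fun i => X i.castSucc
    let S' : ∀ i j, X' i ⟶ X' j := fun i j => S i.castSucc j.castSucc
    let T : ∀ i, X' i ⟶ X (Fin.last n) := fun i => S i.castSucc (Fin.last n)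
    let V : ∀ j, X (Fin.last n) ⟶ X' j := fun j => S (Fin.last n) j.castSucc
    trace₂ Wd
      (traceEntry Wd n X' S' T V (S (Fin.last n) (Fin.last n)))
      (traceEntry Wd n X' S' (fun i => U i.castSucc) V (U (Fin.last n)))
      (traceEntry Wd n X' S' T (fun j => W j.castSucc) (W (Fin.last n)))
      (traceEntry Wd n X' S' (fun i => U i.castSucc) (fun j => W j.castSucc) k)

end Matrix

end RestrCat

open RestrCat

/-!
The matrix category `MAT P hP` behaves like a category of matrices over a semiring whose addition,
the disjoint join `f ⋎ g`, is only partially defined, and the Kleene wand `f ⩘ g` solves the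
equation `x = g ⋎ f x`. The trace of a matrix solves the corresponding system of equations by
eliminating one unknown after the other.

**Algebra of the wand.** Since `f ⩘ g = (f ⩘ rest g) g`, the wand preserves disjointness
(`iter_perp_iter`) and is additive in its second argument (`iter_lub`). The diagonal and
dinaturality axioms then show that elimination of two unknowns gives the same result in either
order (`trace₂_comm`).

**The inductive formula.** Everything that is needed about `traceEntry` follows by induction on
the length of the list that is traced out: it is linear in rows and in columns (`traceEntry_row`,
`traceEntry_column`), tracing out a concatenation is tracing out the two parts (`traceEntry_add`),
and, by `trace₂_comm`, two lists can be traced out in either order (`traceEntry_comm`). If there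
are no maps between the objects that are traced out, then the trace is just the join of the paths
of length one and two (`traceEntry_loop_zero`).

**Trace axioms.** Tightening is linearity and vanishing is `traceEntry_add`. For sliding along
`k : X' ⟶ X`, consider the matrix on `X` and `X'` whose only entries among these objects are a map
`X ⟶ X'` and `k`. Tracing out `X'` first leaves the trace along `X` of the one side, tracing out `X`
first leaves the trace along `X'` of the other side, so that sliding is an instance of
`traceEntry_comm`.

**Disjointness in the matrix category.** Two matrices are decision disjoint exactly if putting them
side by side gives a matrix with disjoint rows (`decisionDisjoint_iff`). This is a finitely
disjoint interference relation (`MAT.finitelyDisjoint`) for which the two quasi-projections of a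
coproduct are disjoint, and this alone gives extensivity (`isExtensive`): the decision of `f` is
the join of the maps `rest (f πᵢ) ιᵢ`.

**The induced wand.** `TraceOperator.kleeneWand` derives the axioms of a Kleene wand from those of
a trace: naturality from tightening, dinaturality from sliding, and the diagonal axiom from
vanishing together with sliding along the codiagonal. The fixed point equation holds because
starting an iteration at an object is the same as starting it one step later
(`traceEntry_unit_row`).
-/

namespace RestrCat

open RestrictionCategory

theorem rest_comp_of_le {C : Type u} [Category.{v} C] [RestrictionCategory C] {A B : C}
    {f g : A ⟶ B} (h : f ≤ g) : rest g ≫ f = f := by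
  rw [le_def] at h
  rw [← h, ← Category.assoc, rest_comm, Category.assoc, rest_comp_self]

namespace Interference

/-! ### Binary disjoint joins -/

section BinaryJoins

variable {C : Type u} [Category.{v} C] [RestrictionCategory C] [RestrictionZeroes C]

/-- The join of two parallel maps. It is meaningful if they are disjoint. -/
noncomputable def join {A B : C} (f g : A ⟶ B) : A ⟶ B := lub {f, g}

infixl:67 " ⋎ " => join

theorem join_comm {A B : C} (f g : A ⟶ B) : f ⋎ g = g ⋎ f := by
  rw [join, join, Set.pair_comm]

theorem join_eq_lub_range {A B : C} (f g : A ⟶ B) :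
    f ⋎ g = lub (Set.range fun b : Bool => bif b then g else f) := by
  rw [join, Bool.range_eq]
  rfl

theorem join_zero {A B : C} (f : A ⟶ B) : f ⋎ 0 = f := by
  apply lub_eq
  constructor
  · rintro _ (rfl | rfl)
    exacts [le_rfl, zero_le' _]
  · exact fun x hx => hx (Or.inl rfl)

theorem zero_join {A B : C} (f : A ⟶ B) : 0 ⋎ f = f := by
  rw [join_comm, join_zero]

variable {P : Interference C}

theorem disj_pair {A B : C} {f g : A ⟶ B} (h : P.perp f g) :
    P.Disj fun b : Bool => bif b then g else f := by
  rintro (_ | _) (_ | _) hij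
  exacts [absurd rfl hij, h, P.symm h, absurd rfl hij]

theorem perp_zero_left {A B B' : C} (f : A ⟶ B) : P.perp (0 : A ⟶ B') f :=
  P.symm (P.perp_zero f)

theorem perp_of_rest {A B B' : C} {f : A ⟶ B} {g : A ⟶ B'}
    (h : P.perp (RestrictionCategory.rest f) (RestrictionCategory.rest g)) : P.perp f g := by
  have := P.perp_comp_right h f g
  rwa [rest_comp_self, rest_comp_self] at this

theorem perp_rest_left {A B B' : C} {f : A ⟶ B} {g : A ⟶ B'} (h : P.perp f g) :
    P.perp (RestrictionCategory.rest f) g := by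
  have := P.perp_comp_right (P.rest h) (𝟙 A) g
  rwa [Category.comp_id, rest_comp_self] at this

theorem perp_rest_right {A B B' : C} {f : A ⟶ B} {g : A ⟶ B'} (h : P.perp f g) :
    P.perp f (RestrictionCategory.rest g) :=
  P.symm (perp_rest_left (P.symm h))

/-- Post-composition on one side preserves disjointness. -/
theorem perp_comp {A B B' D : C} {f : A ⟶ B} {g : A ⟶ B'} (h : P.perp f g) (k : B' ⟶ D) :
    P.perp f (g ≫ k) := by
  simpa using P.perp_comp_right h (𝟙 B) k

namespace FinitelyDisjoint

variable (hP : P.FinitelyDisjoint)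
include hP

theorem isLUB_join {A B : C} {f g : A ⟶ B} (h : P.perp f g) : IsLUB {f, g} (f ⋎ g) := by
  have := hP.isLUB (disj_pair h)
  rwa [← join_eq_lub_range, Bool.range_eq] at this

theorem join_le_iff {A B : C} {f g : A ⟶ B} (h : P.perp f g) (x : A ⟶ B) :
    f ⋎ g ≤ x ↔ f ≤ x ∧ g ≤ x := by
  rw [isLUB_le_iff (hP.isLUB_join h)]
  simp [upperBounds]

theorem comp_join {A' A B : C} {f g : A ⟶ B} (h : P.perp f g) (k : A' ⟶ A) :
    k ≫ (f ⋎ g) = k ≫ f ⋎ k ≫ g := by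
  rw [join_eq_lub_range, join_eq_lub_range, hP.comp_lub (disj_pair h)]
  congr 2
  funext b
  cases b <;> rfl

theorem join_comp {A B D : C} {f g : A ⟶ B} (h : P.perp f g) (k : B ⟶ D) :
    (f ⋎ g) ≫ k = f ≫ k ⋎ g ≫ k := by
  rw [join_eq_lub_range, join_eq_lub_range, hP.lub_comp (disj_pair h)]
  congr 2
  funext b
  cases b <;> rfl

theorem join_perp {A B D : C} {f g : A ⟶ B} {h : A ⟶ D} (hfg : P.perp f g) (hf : P.perp f h)
    (hg : P.perp g h) : P.perp (f ⋎ g) h := by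
  rw [join_eq_lub_range]
  refine hP.strong _ (disj_pair hfg) _ (hP.isLUB (disj_pair hfg)) h ?_
  rintro (_ | _)
  exacts [hf, hg]

theorem perp_join {A B D : C} {f g : A ⟶ B} {h : A ⟶ D} (hfg : P.perp f g) (hf : P.perp h f)
    (hg : P.perp h g) : P.perp h (f ⋎ g) :=
  P.symm (hP.join_perp hfg (P.symm hf) (P.symm hg))

theorem join_assoc {A B : C} {f g h : A ⟶ B} (hfg : P.perp f g) (hfh : P.perp f h)
    (hgh : P.perp g h) : f ⋎ g ⋎ h = f ⋎ (g ⋎ h) := by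
  refine eq_of_forall_ge_iff fun x => ?_
  rw [hP.join_le_iff (hP.join_perp hfg hfh hgh), hP.join_le_iff hfg,
    hP.join_le_iff (hP.perp_join hgh hfg hfh), hP.join_le_iff hgh, and_assoc]

theorem join_right_comm {A B : C} {f g h : A ⟶ B} (hfg : P.perp f g) (hfh : P.perp f h)
    (hgh : P.perp g h) : f ⋎ g ⋎ h = f ⋎ h ⋎ g := by
  rw [hP.join_assoc hfg hfh hgh, join_comm g h, hP.join_assoc hfh hfg (P.symm hgh)]

/-- Disjointness from every member of a finite disjoint family passes to the join. -/
theorem perp_lub_right {A B D : C} {ι : Type} [Finite ι] {f : ι → (A ⟶ B)} (hf : P.Disj f)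
    {h : A ⟶ D} (H : ∀ i, P.perp h (f i)) : P.perp h (lub (Set.range f)) :=
  P.symm (hP.strong f hf _ (hP.isLUB hf) h fun i => P.symm (H i))

theorem lub_join_lub {A B : C} {ι : Type} [Finite ι] {f g : ι → (A ⟶ B)} (hf : P.Disj f)
    (hg : P.Disj g) (hfg : ∀ i j, P.perp (f i) (g j)) :
    lub (Set.range f) ⋎ lub (Set.range g) = lub (Set.range fun i => f i ⋎ g i) := by
  have hd : P.Disj fun i => f i ⋎ g i := fun i j hij =>
    hP.join_perp (hfg i i) (hP.perp_join (hfg j j) (hf i j hij) (hfg i j))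
      (hP.perp_join (hfg j j) (P.symm (hfg j i)) (hg i j hij))
  refine eq_of_forall_ge_iff fun x => ?_
  rw [hP.join_le_iff (hP.perp_lub hf hg hfg), hP.lub_le_iff hf, hP.lub_le_iff hg,
    hP.lub_le_iff hd, ← forall_and]
  exact forall_congr' fun i => (hP.join_le_iff (hfg i i) x).symm

end FinitelyDisjoint

end BinaryJoins

/-! ### The algebra of a Kleene wand -/

namespace KleeneWand

section Wand

variable {C : Type u} [Category.{v} C] [RestrictionCategory C] [RestrictionZeroes C]
  {P : Interference C} (W : P.KleeneWand)

open Classical in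
/-- The Kleene wand as a total operation: `f ⩘ g` if `f` and `g` are disjoint, and `0`
otherwise. -/
noncomputable def iter {X A : C} (f : X ⟶ X) (g : X ⟶ A) : X ⟶ A :=
  if h : P.perp f g then W.wand f g h else 0

theorem iter_of_perp {X A : C} {f : X ⟶ X} {g : X ⟶ A} (h : P.perp f g) :
    W.iter f g = W.wand f g h := dif_pos h

theorem iter_eq {X A : C} {f : X ⟶ X} {g : X ⟶ A} (h : P.perp f g) :
    W.iter f g = g ⋎ f ≫ W.iter f g := by
  rw [W.iter_of_perp h]
  exact (lub_eq (W.iteration f g h)).symm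

theorem iter_comp {X A B : C} {f : X ⟶ X} {g : X ⟶ A} (h : P.perp f g) (k : A ⟶ B) :
    W.iter f g ≫ k = W.iter f (g ≫ k) := by
  have h' : P.perp f (g ≫ k) := perp_comp h k
  rw [W.iter_of_perp h, W.iter_of_perp h', W.naturality f g k h h']

theorem comp_iter {X Y A : C} {f : X ⟶ Y} {g : X ⟶ A} (h : P.perp f g) (k : Y ⟶ X) :
    k ≫ W.iter (f ≫ k) g = W.iter (k ≫ f) (k ≫ g) := by
  have h' : P.perp (f ≫ k) g := P.symm (perp_comp (P.symm h) k)
  rw [W.iter_of_perp (P.perp_comp_left h k), W.iter_of_perp h',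
    W.dinaturality f g k h (P.perp_comp_left h k) h']

theorem iter_zero_left {X A : C} (g : X ⟶ A) : W.iter 0 g = g := by
  rw [W.iter_eq (perp_zero_left g), zero_comp, join_zero]

theorem iter_zero_right {X : C} (A : C) (f : X ⟶ X) : W.iter f (0 : X ⟶ A) = 0 := by
  have h := W.iter_comp (P.perp_zero (B' := X) f) (0 : X ⟶ A)
  rwa [comp_zero, comp_zero, eq_comm] at h

theorem trace₂_eq {X A B : C} {f : X ⟶ X} {g : X ⟶ B} (hfg : P.perp f g) (h : A ⟶ X)
    (k : A ⟶ B) : trace₂ W f g h k = k ⋎ h ≫ W.iter f g := by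
  rw [trace₂, dif_pos hfg, W.iter_of_perp hfg]
  rfl

variable (hP : P.FinitelyDisjoint)
include hP

theorem iter_join_left {X A : C} {f f' : X ⟶ X} {g : X ⟶ A} (hff : P.perp f f')
    (hfg : P.perp f g) (hfg' : P.perp f' g) :
    P.perp (W.iter f f') (W.iter f g) ∧
      W.iter (f ⋎ f') g = W.iter (W.iter f f') (W.iter f g) := by
  have hj := hP.join_perp hff hfg hfg'
  obtain ⟨h', e⟩ := W.diagonal f f' g hff (f ⋎ f') (hP.isLUB_join hff) hj hfg
  rw [← W.iter_of_perp hff, ← W.iter_of_perp hfg] at h'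
  refine ⟨h', ?_⟩
  rw [W.iter_of_perp hj, e, W.iter_of_perp h']
  congr 1 <;> exact (W.iter_of_perp _).symm

/-- The diagonal axiom gives this when `g` is an endomap; the general case follows since
`f ⩘ g = (f ⩘ rest g) g`. -/
theorem iter_perp_iter {X A B : C} {f : X ⟶ X} {g : X ⟶ A} {g' : X ⟶ B} (hg : P.perp f g)
    (hg' : P.perp f g') (hgg : P.perp g g') : P.perp (W.iter f g) (W.iter f g') := by
  have h := (W.iter_join_left hP (perp_rest_right hg) hg' (perp_rest_left hgg)).1
  have h' := P.perp_comp_right h g (𝟙 B)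
  rwa [Category.comp_id, W.iter_comp (perp_rest_right hg), rest_comp_self] at h'

/-- The wand is additive in its second argument. Indeed `f ⩘ g = (f ⩘ rest g) g`, and the right
hand side is additive in `g` for a fixed `rest g`. -/
theorem iter_lub {X A : C} {ι : Type} [Finite ι] {f : X ⟶ X} {g : ι → (X ⟶ A)} (hg : P.Disj g)
    (hfg : ∀ i, P.perp f (g i)) :
    W.iter f (lub (Set.range g)) = lub (Set.range fun i => W.iter f (g i)) := by
  have h := perp_rest_right (hP.perp_lub_right hg hfg)
  conv_lhs => rw [← rest_comp_self (lub (Set.range g)), ← W.iter_comp h, hP.comp_lub hg]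
  congr 2
  funext i
  rw [W.iter_comp h]
  rw [rest_comp_of_le (hP.le_lub hg i)]

theorem iter_join_right {X A : C} {f : X ⟶ X} {g g' : X ⟶ A} (hg : P.perp f g)
    (hg' : P.perp f g') (hgg : P.perp g g') :
    W.iter f (g ⋎ g') = W.iter f g ⋎ W.iter f g' := by
  rw [join_eq_lub_range, join_eq_lub_range, W.iter_lub hP (disj_pair hgg)]
  · congr 2
    funext b
    cases b <;> rfl
  · rintro (_ | _)
    exacts [hg, hg']

/-- The value of `x` in the system `x = xx x ⊔ xy y ⊔ xb`, `y = m x ⊔ n`, found by substituting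
the second equation into the first. -/
theorem iter_subst {x y b : C} {xx : x ⟶ x} {xy : x ⟶ y} {xb : x ⟶ b} {m : y ⟶ x} {n : y ⟶ b}
    (h₁ : P.perp xx xy) (h₂ : P.perp xx xb) (h₃ : P.perp xy xb) (hmn : P.perp m n) :
    W.iter (xx ⋎ xy ≫ m) (xb ⋎ xy ≫ n) =
      W.iter (W.iter xx xy ≫ m) (W.iter xx xb) ⋎
        W.iter xx xy ≫ W.iter (m ≫ W.iter xx xy) n := by
  have hpq := W.iter_perp_iter hP h₁ h₂ h₃
  have h₄ : P.perp xb (xy ≫ n) := perp_comp (P.symm h₃) n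
  rw [(W.iter_join_left hP (perp_comp h₁ m) (hP.perp_join h₄ h₂ (perp_comp h₁ n))
      (hP.perp_join h₄ (P.symm (perp_comp (P.symm h₃) m)) (P.perp_comp_left hmn xy))).2,
    W.iter_join_right hP h₂ (perp_comp h₁ n) h₄, ← W.iter_comp h₁, ← W.iter_comp h₁,
    W.iter_join_right hP (P.symm (perp_comp (P.symm hpq) m)) (P.perp_comp_left hmn _)
      (perp_comp (P.symm hpq) n), ← W.comp_iter hmn]

/-- Solving for `x` first or for `y` first in the system
`x = xx x ⊔ xy y ⊔ xb`, `y = yx x ⊔ yy y ⊔ yb` gives the same value of `x`. -/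
theorem iter_elimination {x y b : C} {xx : x ⟶ x} {xy : x ⟶ y} {xb : x ⟶ b} {yx : y ⟶ x}
    {yy : y ⟶ y} {yb : y ⟶ b} (h₁ : P.perp xx xy) (h₂ : P.perp xx xb) (h₃ : P.perp xy xb)
    (h₄ : P.perp yy yx) (h₅ : P.perp yy yb) (h₆ : P.perp yx yb) :
    W.iter (xx ⋎ xy ≫ W.iter yy yx) (xb ⋎ xy ≫ W.iter yy yb) =
      W.iter xx xb ⋎
        W.iter xx xy ≫ W.iter (yy ⋎ yx ≫ W.iter xx xy) (yb ⋎ yx ≫ W.iter xx xb) := by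
  have hpq := W.iter_perp_iter hP h₁ h₂ h₃
  have hmn := W.iter_perp_iter hP h₄ h₅ h₆
  rw [W.iter_subst hP h₁ h₂ h₃ hmn, W.iter_subst hP h₄ h₅ h₆ hpq]
  generalize W.iter xx xb = q at *
  generalize W.iter xx xy = p at *
  generalize W.iter yy yx = m at *
  generalize W.iter yy yb = n at *
  have hpm : P.perp (p ≫ m) q := P.symm (perp_comp (P.symm hpq) m)
  have hmp : P.perp (m ≫ p) n := P.symm (perp_comp (P.symm hmn) p)
  have hc : m ≫ W.iter (p ≫ m) q = W.iter (m ≫ p) (m ≫ q) := W.comp_iter hpq m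
  have h : P.perp (m ≫ W.iter (p ≫ m) q) (W.iter (m ≫ p) n) := by
    rw [hc]
    exact W.iter_perp_iter hP (P.perp_comp_left hpq m) hmp (P.symm (perp_comp (P.symm hmn) q))
  conv_lhs => rw [W.iter_eq hpm]
  rw [hP.comp_join (P.symm h), Category.assoc, join_comm (p ≫ _), hP.join_assoc (perp_comp (P.symm hpq) _)
    (perp_comp (P.symm hpq) _) (P.perp_comp_left h p), join_comm (p ≫ _)]

/-- Elimination preserves disjointness of rows. -/
theorem trace₂_perp_trace₂ {x a b b' : C} {f : x ⟶ x} {g : x ⟶ b} {g' : x ⟶ b'} {h : a ⟶ x}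
    {k : a ⟶ b} {k' : a ⟶ b'} (h₁ : P.perp f g) (h₂ : P.perp f g') (h₃ : P.perp g g')
    (h₄ : P.perp h k) (h₅ : P.perp h k') (h₆ : P.perp k k') :
    P.perp (trace₂ W f g h k) (trace₂ W f g' h k') := by
  rw [trace₂_eq W h₁, trace₂_eq W h₂]
  have h' := perp_comp (P.symm h₅) (W.iter f g)
  have h'' := perp_comp (P.symm h₄) (W.iter f g')
  exact hP.perp_join (perp_comp (P.symm h₅) _)
    (hP.join_perp (perp_comp (P.symm h₄) _) h₆ (P.symm h'))
    (hP.join_perp (perp_comp (P.symm h₄) _) h''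
      (P.perp_comp_left (W.iter_perp_iter hP h₁ h₂ h₃) h))

/-- Elimination of `x` and elimination of `y` commute. -/
theorem trace₂_comm {x y a b : C} {xx : x ⟶ x} {xy : x ⟶ y} {xb : x ⟶ b} {yx : y ⟶ x}
    {yy : y ⟶ y} {yb : y ⟶ b} {ax : a ⟶ x} {ay : a ⟶ y} {ab : a ⟶ b}
    (h₁ : P.perp xx xy) (h₂ : P.perp xx xb) (h₃ : P.perp xy xb)
    (h₄ : P.perp yy yx) (h₅ : P.perp yy yb) (h₆ : P.perp yx yb)
    (h₇ : P.perp ax ay) (h₈ : P.perp ax ab) (h₉ : P.perp ay ab) :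
    trace₂ W (trace₂ W xx xy yx yy) (trace₂ W xx xb yx yb) (trace₂ W xx xy ax ay)
        (trace₂ W xx xb ax ab) =
      trace₂ W (trace₂ W yy yx xy xx) (trace₂ W yy yb xy xb) (trace₂ W yy yx ay ax)
        (trace₂ W yy yb ay ab) := by
  -- both sides are brought into the form `ab ⊔ ay y ⊔ ax x` for the solution `(x, y)`
  have e : ∀ {x b : C} {ax : a ⟶ x} {ab ay : a ⟶ b} {q w : x ⟶ b}, P.perp ab ax → P.perp ab ay →
      P.perp ay ax → P.perp q w → ab ⋎ ax ≫ q ⋎ (ay ⋎ ax ≫ w) = ab ⋎ ay ⋎ ax ≫ (q ⋎ w) := by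
    intro x b ax ab ay q w h₁ h₂ h₃ h
    have h' := P.perp_comp_left h ax
    rw [hP.comp_join h, ← hP.join_assoc (hP.join_perp (perp_comp h₁ q) h₂
        (P.symm (perp_comp h₃ q))) (hP.join_perp (perp_comp h₁ q) (perp_comp h₁ w) h')
        (perp_comp h₃ w), hP.join_right_comm (perp_comp h₁ q) h₂ (P.symm (perp_comp h₃ q)),
      hP.join_assoc (hP.join_perp h₂ (perp_comp h₁ q) (perp_comp h₃ q))
        (hP.join_perp h₂ (perp_comp h₁ w) (perp_comp h₃ w)) h']
  have hpq := W.iter_perp_iter hP h₁ h₂ h₃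
  have hmn := W.iter_perp_iter hP h₄ h₅ h₆
  have hX := W.iter_elimination hP h₁ h₂ h₃ h₄ h₅ h₆
  have hY := W.iter_elimination hP h₄ h₅ h₆ h₁ h₂ h₃
  rw [trace₂_eq W (W.trace₂_perp_trace₂ hP h₁ h₂ h₃ (P.symm h₄) h₆ h₅),
    trace₂_eq W (W.trace₂_perp_trace₂ hP h₄ h₅ h₆ (P.symm h₁) h₃ h₂)]
  simp only [trace₂_eq W h₁, trace₂_eq W h₂, trace₂_eq W h₄, trace₂_eq W h₅]
  rw [hP.join_comp (perp_comp (P.symm h₇) _), hP.join_comp (perp_comp h₇ _), Category.assoc,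
    Category.assoc, e (P.symm h₈) (perp_comp (P.symm h₉) _) (P.symm (perp_comp h₇ _))
      (perp_comp (P.symm hpq) _), ← hX, e (P.symm h₉) (perp_comp (P.symm h₈) _)
      (P.symm (perp_comp (P.symm h₇) _)) (perp_comp (P.symm hmn) _), ← hY]
  exact hP.join_right_comm (perp_comp (P.symm h₉) _) (perp_comp (P.symm h₈) _)
    (perp_comp (P.symm (perp_comp h₇ _)) _)

end Wand

end KleeneWand

end Interference

/-! ### The inductive trace formula -/

namespace Interference

/-- The row `(R, k)` of maps out of `a` is disjoint: its entries are pairwise disjoint. -/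
structure RowDisjoint {C : Type u} [Category.{v} C] [RestrictionCategory C] [RestrictionZeroes C]
    (P : Interference C) {n : ℕ} {X : Fin n → C} {a b : C} (R : ∀ j, a ⟶ X j) (k : a ⟶ b) :
    Prop where
  disj : P.Disj R
  perp : ∀ j, P.perp (R j) k

/-- The row `(R, T, k)` of maps out of `a`, with two blocks and one more entry, is disjoint. -/
structure RowDisjoint₂ {C : Type u} [Category.{v} C] [RestrictionCategory C]
    [RestrictionZeroes C] (P : Interference C) {a b : C} {n m : ℕ}
    {X : Fin n → C} {Y : Fin m → C} (R : ∀ j, a ⟶ X j) (T : ∀ j, a ⟶ Y j) (k : a ⟶ b) :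
    Prop where
  fst : P.RowDisjoint R k
  snd : P.RowDisjoint T k
  perp : ∀ i j, P.perp (R i) (T j)

namespace RowDisjoint

variable {C : Type u} [Category.{v} C] [RestrictionCategory C] [RestrictionZeroes C]
  {P : Interference C} {a b : C}

theorem zero {n : ℕ} {X : Fin n → C} (k : a ⟶ b) : P.RowDisjoint (fun j => (0 : a ⟶ X j)) k :=
  ⟨fun _ _ _ => P.perp_zero _, fun _ => perp_zero_left _⟩

theorem init {n : ℕ} {X : Fin (n + 1) → C} {R : ∀ j, a ⟶ X j} {k : a ⟶ b}
    (h : P.RowDisjoint R k) : P.RowDisjoint (fun j : Fin n => R j.castSucc) k :=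
  ⟨fun _ _ hij => h.disj _ _ fun e => hij (Fin.castSucc_injective n e), fun _ => h.perp _⟩

theorem last {n : ℕ} {X : Fin (n + 1) → C} {R : ∀ j, a ⟶ X j} {k : a ⟶ b}
    (h : P.RowDisjoint R k) : P.RowDisjoint (fun j : Fin n => R j.castSucc) (R (Fin.last n)) :=
  ⟨h.init.disj, fun j => h.disj _ _ (Fin.castSucc_lt_last j).ne⟩

end RowDisjoint

namespace RowDisjoint₂

variable {C : Type u} [Category.{v} C] [RestrictionCategory C] [RestrictionZeroes C]
  {P : Interference C} {a b : C} {n m : ℕ} {X : Fin n → C}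

theorem symm {Y : Fin m → C} {R : ∀ j, a ⟶ X j} {T : ∀ j, a ⟶ Y j} {k : a ⟶ b}
    (h : P.RowDisjoint₂ R T k) : P.RowDisjoint₂ T R k :=
  ⟨h.snd, h.fst, fun i j => P.symm (h.perp j i)⟩

theorem init {Y : Fin (m + 1) → C} {R : ∀ j, a ⟶ X j} {T : ∀ j, a ⟶ Y j} {k : a ⟶ b}
    (h : P.RowDisjoint₂ R T k) : P.RowDisjoint₂ R (fun j : Fin m => T j.castSucc) k :=
  ⟨h.fst, h.snd.init, fun _ _ => h.perp _ _⟩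

theorem last {Y : Fin (m + 1) → C} {R : ∀ j, a ⟶ X j} {T : ∀ j, a ⟶ Y j} {k : a ⟶ b}
    (h : P.RowDisjoint₂ R T k) :
    P.RowDisjoint₂ R (fun j : Fin m => T j.castSucc) (T (Fin.last m)) :=
  ⟨⟨h.fst.disj, fun _ => h.perp _ _⟩, h.snd.last, fun _ _ => h.perp _ _⟩

end RowDisjoint₂

namespace KleeneWand

section TraceEntry

variable {C : Type u} [Category.{v} C] [RestrictionCategory C] [RestrictionZeroes C]
  {P : Interference C} (W : P.KleeneWand)

theorem traceEntry_succ {n : ℕ} (X : Fin (n + 1) → C) {a b : C} (S : ∀ i j, X i ⟶ X j)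
    (U : ∀ i, X i ⟶ b) (R : ∀ j, a ⟶ X j) (k : a ⟶ b) :
    traceEntry W (n + 1) X S U R k =
      trace₂ W
        (traceEntry W n (fun i => X i.castSucc) (fun i j => S i.castSucc j.castSucc)
          (fun i => S i.castSucc (Fin.last n)) (fun j => S (Fin.last n) j.castSucc)
          (S (Fin.last n) (Fin.last n)))
        (traceEntry W n (fun i => X i.castSucc) (fun i j => S i.castSucc j.castSucc)
          (fun i => U i.castSucc) (fun j => S (Fin.last n) j.castSucc) (U (Fin.last n)))
        (traceEntry W n (fun i => X i.castSucc) (fun i j => S i.castSucc j.castSucc)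
          (fun i => S i.castSucc (Fin.last n)) (fun j => R j.castSucc) (R (Fin.last n)))
        (traceEntry W n (fun i => X i.castSucc) (fun i j => S i.castSucc j.castSucc)
          (fun i => U i.castSucc) (fun j => R j.castSucc) k) := rfl

/-- Tracing out a concatenation of two lists is tracing out the first list and then the second. -/
theorem traceEntry_add {n m : ℕ} (X : Fin (n + m) → C) {a b : C} (S : ∀ i j, X i ⟶ X j)
    (U : ∀ i, X i ⟶ b) (R : ∀ j, a ⟶ X j) (k : a ⟶ b) :
    traceEntry W (n + m) X S U R k =
      traceEntry W m (fun i => X (Fin.natAdd n i))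
        (fun i j => traceEntry W n (fun i => X (Fin.castAdd m i))
          (fun i j => S (Fin.castAdd m i) (Fin.castAdd m j))
          (fun i' => S (Fin.castAdd m i') (Fin.natAdd n j))
          (fun j' => S (Fin.natAdd n i) (Fin.castAdd m j'))
          (S (Fin.natAdd n i) (Fin.natAdd n j)))
        (fun i => traceEntry W n (fun i => X (Fin.castAdd m i))
          (fun i j => S (Fin.castAdd m i) (Fin.castAdd m j))
          (fun i' => U (Fin.castAdd m i'))
          (fun j' => S (Fin.natAdd n i) (Fin.castAdd m j'))
          (U (Fin.natAdd n i)))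
        (fun j => traceEntry W n (fun i => X (Fin.castAdd m i))
          (fun i j => S (Fin.castAdd m i) (Fin.castAdd m j))
          (fun i' => S (Fin.castAdd m i') (Fin.natAdd n j))
          (fun j' => R (Fin.castAdd m j'))
          (R (Fin.natAdd n j)))
        (traceEntry W n (fun i => X (Fin.castAdd m i))
          (fun i j => S (Fin.castAdd m i) (Fin.castAdd m j))
          (fun i' => U (Fin.castAdd m i'))
          (fun j' => R (Fin.castAdd m j')) k) := by
  induction m generalizing a b with
  | zero => rfl
  | succ m ih =>
    rw [traceEntry_succ W (n := m)]
    change traceEntry W ((n + m) + 1) X S U R k = _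
    rw [traceEntry_succ W (n := n + m)]
    simp only [ih]
    rfl

/-- The trace does not change if the objects are replaced by equal ones. -/
theorem traceEntry_eqToHom {n : ℕ} {X X' : Fin n → C} {a a' b b' : C}
    (hX : ∀ i, X i = X' i) (ha : a = a') (hb : b = b')
    {S : ∀ i j, X i ⟶ X j} {U : ∀ i, X i ⟶ b} {R : ∀ j, a ⟶ X j} {k : a ⟶ b}
    {S' : ∀ i j, X' i ⟶ X' j} {U' : ∀ i, X' i ⟶ b'} {R' : ∀ j, a' ⟶ X' j} {k' : a' ⟶ b'}
    (hS : ∀ i j, S i j = eqToHom (hX i) ≫ S' i j ≫ eqToHom (hX j).symm)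
    (hU : ∀ i, U i = eqToHom (hX i) ≫ U' i ≫ eqToHom hb.symm)
    (hR : ∀ j, R j = eqToHom ha ≫ R' j ≫ eqToHom (hX j).symm)
    (hk : k = eqToHom ha ≫ k' ≫ eqToHom hb.symm) :
    traceEntry W n X S U R k =
      eqToHom ha ≫ traceEntry W n X' S' U' R' k' ≫ eqToHom hb.symm := by
  obtain rfl : X = X' := funext hX
  subst ha hb
  simp only [eqToHom_refl, Category.id_comp, Category.comp_id] at hS hU hR hk ⊢
  obtain rfl : S = S' := funext fun i => funext fun j => hS i j
  obtain rfl : U = U' := funext hU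
  obtain rfl : R = R' := funext hR
  rw [hk]

/-- Tracing out preserves disjointness of rows. -/
theorem traceEntry_perp (hP : P.FinitelyDisjoint) {n : ℕ} {X : Fin n → C} {a b b' : C}
    {S : ∀ i j, X i ⟶ X j} {U : ∀ i, X i ⟶ b} {U' : ∀ i, X i ⟶ b'} {R : ∀ j, a ⟶ X j}
    {k : a ⟶ b} {k' : a ⟶ b'} (hS : ∀ i, P.RowDisjoint (S i) (U i))
    (hS' : ∀ i, P.RowDisjoint (S i) (U' i)) (hU : ∀ i, P.perp (U i) (U' i))
    (hR : P.RowDisjoint R k) (hR' : P.RowDisjoint R k') (hk : P.perp k k') :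
    P.perp (traceEntry W n X S U R k) (traceEntry W n X S U' R k') := by
  induction n generalizing a b b' with
  | zero => exact hk
  | succ n ih =>
    have h₁ := fun i : Fin n => (hS i.castSucc).init
    have h₂ := fun i : Fin n => (hS i.castSucc).last
    have h₃ := fun i : Fin n => (hS' i.castSucc).init
    have h₄ := fun i : Fin n => (hS i.castSucc).perp (Fin.last n)
    have h₅ := fun i : Fin n => (hS' i.castSucc).perp (Fin.last n)
    have h₆ := fun i : Fin n => hU i.castSucc
    have hl := hS (Fin.last n)
    have hl' := hS' (Fin.last n)
    exact W.trace₂_perp_trace₂ hP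
      (ih h₂ h₁ h₄ hl.last hl.init (hl.perp _)) (ih h₂ h₃ h₅ hl.last hl'.init (hl'.perp _))
      (ih h₁ h₃ h₆ hl.init hl'.init (hU _)) (ih h₂ h₁ h₄ hR.last hR.init (hR.perp _))
      (ih h₂ h₃ h₅ hR.last hR'.init (hR'.perp _)) (ih h₁ h₃ h₆ hR.init hR'.init hk)

/-- Tracing out the first block of the columns of a matrix with disjoint rows leaves disjoint
rows. -/
theorem traceEntry_rowDisjoint (hP : P.FinitelyDisjoint) {n m : ℕ} {X : Fin n → C}
    {Y : Fin m → C} {a b : C} {S : ∀ i j, X i ⟶ X j} {U : ∀ i j, X i ⟶ Y j} {V : ∀ i, X i ⟶ b}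
    {R : ∀ j, a ⟶ X j} {k : ∀ j, a ⟶ Y j} {q : a ⟶ b}
    (hS : ∀ i, P.RowDisjoint₂ (S i) (U i) (V i)) (hR : P.RowDisjoint₂ R k q) :
    P.RowDisjoint (fun j => traceEntry W n X S (fun i => U i j) R (k j))
      (traceEntry W n X S V R q) :=
  ⟨fun _ _ hj => W.traceEntry_perp hP (fun i => ⟨(hS i).fst.disj, fun _ => (hS i).perp _ _⟩)
      (fun i => ⟨(hS i).fst.disj, fun _ => (hS i).perp _ _⟩) (fun i => (hS i).snd.disj _ _ hj)
      ⟨hR.fst.disj, fun _ => hR.perp _ _⟩ ⟨hR.fst.disj, fun _ => hR.perp _ _⟩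
      (hR.snd.disj _ _ hj),
    fun _ => W.traceEntry_perp hP (fun i => ⟨(hS i).fst.disj, fun _ => (hS i).perp _ _⟩)
      (fun i => (hS i).fst) (fun i => (hS i).snd.perp _) ⟨hR.fst.disj, fun _ => hR.perp _ _⟩
      hR.fst (hR.snd.perp _)⟩

/-- When all but the last of `n + 1` objects are traced out, the row `(R, k)` stays disjoint. -/
theorem traceEntry_last_perp (hP : P.FinitelyDisjoint) {n : ℕ} {X : Fin (n + 1) → C} {a b : C}
    {S : ∀ i j, X i ⟶ X j} {U : ∀ i, X i ⟶ b} {R : ∀ j, a ⟶ X j} {k : a ⟶ b}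
    (hS : ∀ i, P.RowDisjoint (S i) (U i)) (hR : P.RowDisjoint R k) :
    P.perp
      (traceEntry W n (fun i => X i.castSucc) (fun i j => S i.castSucc j.castSucc)
        (fun i => S i.castSucc (Fin.last n)) (fun j => R j.castSucc) (R (Fin.last n)))
      (traceEntry W n (fun i => X i.castSucc) (fun i j => S i.castSucc j.castSucc)
        (fun i => U i.castSucc) (fun j => R j.castSucc) k) :=
  W.traceEntry_perp hP (fun i => (hS i.castSucc).last) (fun i => (hS i.castSucc).init)
    (fun i => (hS i.castSucc).perp _) hR.last hR.init (hR.perp _)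

theorem traceEntry_row_zero (hP : P.FinitelyDisjoint) {n : ℕ} {X : Fin n → C} {a b : C}
    {S : ∀ i j, X i ⟶ X j} {U : ∀ i, X i ⟶ b} (k : a ⟶ b)
    (hS : ∀ i, P.RowDisjoint (S i) (U i)) :
    traceEntry W n X S U (fun _ => 0) k = k := by
  induction n generalizing a b with
  | zero => rfl
  | succ n ih =>
    rw [traceEntry_succ, trace₂_eq W (W.traceEntry_last_perp hP hS (hS _)),
      ih _ fun i => (hS i.castSucc).init, ih _ fun i => (hS i.castSucc).last, zero_comp, join_zero]

theorem traceEntry_column_zero (hP : P.FinitelyDisjoint) {n : ℕ} {X : Fin n → C} {a b : C}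
    {S : ∀ i j, X i ⟶ X j} (R : ∀ j, a ⟶ X j) (k : a ⟶ b) (hS : ∀ i, P.Disj (S i)) :
    traceEntry W n X S (fun _ => 0) R k = k := by
  induction n generalizing a b with
  | zero => rfl
  | succ n ih =>
    have hS' : ∀ i, P.RowDisjoint (S i) (0 : X i ⟶ b) := fun i => ⟨hS i, fun _ => P.perp_zero _⟩
    have h := W.traceEntry_last_perp hP hS' (hS' (Fin.last n))
    rw [traceEntry_succ, trace₂_eq W h, ih _ _ fun i => (hS' i.castSucc).init.disj,
      ih _ _ fun i => (hS' i.castSucc).init.disj, iter_zero_right, comp_zero, join_zero]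

/-- If there are no maps between the objects that are traced out, then the trace is the join of the
direct map and of the maps that pass through one of these objects. -/
theorem traceEntry_loop_zero (hP : P.FinitelyDisjoint) {n : ℕ} {X : Fin n → C} {a b : C}
    (U : ∀ i, X i ⟶ b) {R : ∀ j, a ⟶ X j} {k : a ⟶ b} (hR : P.RowDisjoint R k) :
    traceEntry W n X (fun _ _ => 0) U R k = k ⋎ lub (Set.range fun i => R i ≫ U i) := by
  induction n generalizing a b with
  | zero => rw [lub_zero _ fun j : Fin 0 => j.elim0, join_zero]; rfl
  | succ n ih =>
    have hS : ∀ i, P.RowDisjoint (fun j => (0 : X i ⟶ X j)) (U i) := fun i => .zero (U i)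
    have hS' : ∀ i : Fin n, P.Disj fun j : Fin n => (0 : X i.castSucc ⟶ X j.castSucc) :=
      fun i => (hS i.castSucc).init.disj
    have hd := hR.disj.comp_right U
    have hp : ∀ i, P.perp k (R i ≫ U i) := fun i => perp_comp (P.symm (hR.perp i)) _
    rw [traceEntry_succ, trace₂_eq W (W.traceEntry_last_perp hP hS (hS _)),
      W.traceEntry_row_zero hP _ fun i => (hS i.castSucc).init,
      W.traceEntry_row_zero hP _ fun i => (hS i.castSucc).last, iter_zero_left,
      W.traceEntry_column_zero hP _ _ hS', ih _ hR.init]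
    have hd' : P.Disj fun i : Fin n => R i.castSucc ≫ U i.castSucc :=
      fun i j hij => hd _ _ fun e => hij (Fin.castSucc_injective n e)
    have hp' := hP.perp_lub_right hd' fun i => hp i.castSucc
    refine eq_of_forall_ge_iff fun x => ?_
    rw [hP.join_le_iff (hP.join_perp hp' (hp _) (P.symm (hP.perp_lub_right hd' fun i => hd _ _
      (Fin.castSucc_lt_last i).ne'))), hP.join_le_iff hp',
      hP.join_le_iff (hP.perp_lub_right hd hp), hP.lub_le_iff hd, hP.lub_le_iff hd',
      Fin.forall_fin_succ', and_assoc]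

/-- The trace is linear in the last column of the matrix. -/
theorem traceEntry_column (hP : P.FinitelyDisjoint) {n : ℕ} {X : Fin n → C} {a d : C} {ι : Type}
    [Finite ι] {B : ι → C} {S : ∀ i j, X i ⟶ X j} {U : ∀ c i, X i ⟶ B c} {R : ∀ j, a ⟶ X j}
    {k : ∀ c, a ⟶ B c} (h : ∀ c, B c ⟶ d) (hS : ∀ i c, P.RowDisjoint (S i) (U c i))
    (hU : ∀ i, P.Disj fun c => U c i) (hR : ∀ c, P.RowDisjoint R (k c)) (hk : P.Disj k)
    (hS' : ∀ i, P.Disj (S i)) (hR' : P.Disj R) :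
    traceEntry W n X S (fun i => lub (Set.range fun c => U c i ≫ h c)) R
        (lub (Set.range fun c => k c ≫ h c)) =
      lub (Set.range fun c => traceEntry W n X S (U c) R (k c) ≫ h c) := by
  induction n generalizing a with
  | zero => rfl
  | succ n ih =>
    have hlub : ∀ {e : C} {r : ∀ j, e ⟶ X j} {q : ∀ c, e ⟶ B c}, P.Disj r → P.Disj q →
        (∀ c, P.RowDisjoint r (q c)) → P.RowDisjoint r (lub (Set.range fun c => q c ≫ h c)) :=
      fun hr hq hrq => ⟨hr, fun j => hP.perp_lub_right (hq.comp_right h)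
        fun c => perp_comp ((hrq c).perp j) _⟩
    have hSU := fun i => hlub (hS' i) (hU i) (hS i)
    have hD : ∀ {e : C} {r : ∀ j, e ⟶ X j}, P.Disj r → P.Disj fun j : Fin n => r j.castSucc :=
      fun hr i j hij => hr _ _ fun e => hij (Fin.castSucc_injective n e)
    have hl := fun c => W.traceEntry_last_perp hP (fun i => hS i c) (hS (Fin.last n) c)
    have hkd : ∀ {e : C} {r : ∀ j, e ⟶ X j} {q : ∀ c, e ⟶ B c}, P.Disj q →
        (∀ c, P.RowDisjoint r (q c)) → P.Disj fun c => traceEntry W n (fun i => X i.castSucc)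
          (fun i j => S i.castSucc j.castSucc) (fun i => U c i.castSucc) (fun j => r j.castSucc)
          (q c) := fun hq hrq c c' hc => W.traceEntry_perp hP (fun i => (hS _ c).init)
            (fun i => (hS _ c').init) (fun i => hU _ c c' hc) (hrq c).init (hrq c').init
            (hq c c' hc)
    rw [traceEntry_succ, trace₂_eq W (W.traceEntry_last_perp hP hSU (hSU _)),
      ih (fun i c => (hS i.castSucc c).init) (fun i => hU _) (fun c => (hR c).init) hk
        (fun i => hD (hS' _)) (hD hR'),
      ih (fun i c => (hS i.castSucc c).init) (fun i => hU _) (fun c => (hS (Fin.last n) c).init)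
        (hU _) (fun i => hD (hS' _)) (hD (hS' _)),
      W.iter_lub hP ((hkd (hU _) (hS _)).comp_right h) fun c => perp_comp (hl c) _]
    have hg := (hkd (hU _) (hS (Fin.last n))).comp_right h
    have hi : P.Disj fun c => W.iter _ (traceEntry W n (fun i => X i.castSucc)
        (fun i j => S i.castSucc j.castSucc) (fun i => U c i.castSucc)
        (fun j => S (Fin.last n) j.castSucc) (U c (Fin.last n)) ≫ h c) := fun c c' hc =>
      W.iter_perp_iter hP (perp_comp (hl c) _) (perp_comp (hl c') _) (hg c c' hc)
    have hr := fun c => W.traceEntry_last_perp hP (fun i => hS i c) (hR c)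
    rw [hP.comp_lub hi, hP.lub_join_lub ((hkd hk hR).comp_right h) (hi.comp_left _)
      fun c c' => P.symm (P.perp_comp_right (hr c) _ _)]
    congr 2
    funext c
    rw [traceEntry_succ W X S, trace₂_eq W (hl c), hP.join_comp (perp_comp (P.symm (hr c)) _),
      Category.assoc, W.iter_comp (hl c)]

/-- The trace is linear in the last row of the matrix. -/
theorem traceEntry_row (hP : P.FinitelyDisjoint) {n : ℕ} {X : Fin n → C} {a b : C} {ι : Type}
    [Finite ι] {A : ι → C} {S : ∀ i j, X i ⟶ X j} {U : ∀ i, X i ⟶ b} {g : ∀ c, a ⟶ A c}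
    {R : ∀ c j, A c ⟶ X j} {k : ∀ c, A c ⟶ b} (hS : ∀ i, P.RowDisjoint (S i) (U i))
    (hg : P.Disj g) (hR : ∀ c, P.RowDisjoint (R c) (k c)) :
    traceEntry W n X S U (fun j => lub (Set.range fun c => g c ≫ R c j))
        (lub (Set.range fun c => g c ≫ k c)) =
      lub (Set.range fun c => g c ≫ traceEntry W n X S U (R c) (k c)) := by
  induction n generalizing b with
  | zero => rfl
  | succ n ih =>
    rw [traceEntry_succ, trace₂_eq W (W.traceEntry_last_perp hP hS (hS _)),
      ih (fun i => (hS i.castSucc).last) (fun c => (hR c).last),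
      ih (fun i => (hS i.castSucc).init) (fun c => (hR c).init),
      hP.lub_comp (hg.comp_right _)]
    have hr := fun c => W.traceEntry_last_perp hP hS (hR c)
    rw [hP.lub_join_lub (hg.comp_right _) ((hg.comp_right _).comp_right _)]
    · congr 2
      funext c
      rw [traceEntry_succ W X S, trace₂_eq W (W.traceEntry_last_perp hP hS (hS _)),
        hP.comp_join (perp_comp (P.symm (hr c)) _), Category.assoc]
    · intro c c'
      by_cases hc : c = c'
      · subst hc
        exact perp_comp (P.perp_comp_left (P.symm (hr c)) _) _
      · exact perp_comp (P.perp_comp_right (hg c c' hc) _ _) _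

/-- Starting the iteration at the object `X i` is the same as starting it after one step from
`X i`. -/
theorem traceEntry_unit_row (hP : P.FinitelyDisjoint) {n : ℕ} {X : Fin n → C} {b : C}
    {S : ∀ i j, X i ⟶ X j} {U : ∀ i, X i ⟶ b} (hS : ∀ i, P.RowDisjoint (S i) (U i)) (i : Fin n)
    {e : ∀ j, X i ⟶ X j} (he : e i = 𝟙 _) (he' : ∀ j, j ≠ i → e j = 0) :
    traceEntry W n X S U e 0 = traceEntry W n X S U (S i) (U i) := by
  induction n generalizing b with
  | zero => exact i.elim0
  | succ n ih =>
    have hl := W.traceEntry_last_perp hP hS (hS (Fin.last n))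
    have h₁ := fun i : Fin n => (hS i.castSucc).init
    have h₂ := fun i : Fin n => (hS i.castSucc).last
    rw [traceEntry_succ W X S U e, traceEntry_succ W X S U (S i)]
    obtain ⟨i, rfl⟩ | rfl := i.eq_castSucc_or_eq_last
    swap
    · have h0 : (fun j : Fin n => e j.castSucc) = fun _ => 0 :=
        funext fun j => he' _ (Fin.castSucc_lt_last j).ne
      rw [trace₂_eq W hl, trace₂_eq W hl, ← W.iter_eq hl, h0, W.traceEntry_row_zero hP _ h₁,
        W.traceEntry_row_zero hP _ h₂, zero_join, he, Category.id_comp]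
    · have h0 : e (Fin.last n) = 0 := he' _ (Fin.castSucc_lt_last i).ne'
      have h1 : ∀ j : Fin n, j ≠ i → e j.castSucc = 0 := fun j hj =>
        he' _ fun h => hj (Fin.castSucc_injective n h)
      rw [h0, ih h₁ i he h1, ih h₂ i he h1]

/-- Tracing out a list and tracing out a single object commute. -/
theorem traceEntry_trace₂_comm (hP : P.FinitelyDisjoint) {n : ℕ} {X : Fin n → C} {y a b : C}
    {S : ∀ i j, X i ⟶ X j} {Sy : ∀ i, X i ⟶ y} {U : ∀ i, X i ⟶ b} {R : ∀ j, a ⟶ X j}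
    {yS : ∀ j, y ⟶ X j} {yy : y ⟶ y} {yb : y ⟶ b} {ay : a ⟶ y} {k : a ⟶ b}
    (h₁ : ∀ i, P.RowDisjoint (S i) (Sy i)) (h₂ : ∀ i, P.RowDisjoint (S i) (U i))
    (h₃ : ∀ i, P.perp (Sy i) (U i)) (h₄ : P.RowDisjoint yS yy) (h₅ : P.RowDisjoint yS yb)
    (h₆ : P.perp yy yb) (h₇ : P.RowDisjoint R ay) (h₈ : P.RowDisjoint R k) (h₉ : P.perp ay k) :
    trace₂ W (traceEntry W n X S Sy yS yy) (traceEntry W n X S U yS yb)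
        (traceEntry W n X S Sy R ay) (traceEntry W n X S U R k) =
      traceEntry W n X (fun i j => trace₂ W yy (yS j) (Sy i) (S i j))
        (fun i => trace₂ W yy yb (Sy i) (U i)) (fun j => trace₂ W yy (yS j) ay (R j))
        (trace₂ W yy yb ay k) := by
  induction n generalizing a b with
  | zero => rfl
  | succ n ih =>
    have hS₁ := fun i : Fin n => (h₁ i.castSucc).init
    have hS₂ := fun i : Fin n => (h₂ i.castSucc).init
    have hS₃ := fun i : Fin n => (h₁ i.castSucc).last
    have hS₄ := fun i : Fin n => P.symm ((h₁ i.castSucc).perp (Fin.last n))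
    have hS₅ := fun i : Fin n => h₃ i.castSucc
    have hx₁ := h₁ (Fin.last n)
    have hx₂ := h₂ (Fin.last n)
    simp only [traceEntry_succ]
    rw [← ih hS₁ hS₃ hS₄ h₄.init h₄.last (P.symm (h₄.perp _)) hx₁.init hx₁.last
        (P.symm (hx₁.perp _)),
      ← ih hS₁ hS₂ hS₅ h₄.init h₅.init h₆ hx₁.init hx₂.init (h₃ _),
      ← ih hS₁ hS₃ hS₄ h₄.init h₄.last (P.symm (h₄.perp _)) h₇.init h₇.last (P.symm (h₇.perp _)),
      ← ih hS₁ hS₂ hS₅ h₄.init h₅.init h₆ h₇.init h₈.init h₉]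
    have hS₄' := fun i : Fin n => (h₁ i.castSucc).perp (Fin.last n)
    have hS₆ := fun i : Fin n => (h₂ i.castSucc).perp (Fin.last n)
    exact W.trace₂_comm hP
      (W.traceEntry_perp hP hS₃ hS₁ hS₄' hx₁.last hx₁.init (hx₁.perp _))
      (W.traceEntry_perp hP hS₃ hS₂ hS₆ hx₁.last hx₂.init (hx₂.perp _))
      (W.traceEntry_perp hP hS₁ hS₂ hS₅ hx₁.init hx₂.init (h₃ _))
      (W.traceEntry_perp hP hS₁ hS₃ hS₄ h₄.init h₄.last (P.symm (h₄.perp _)))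
      (W.traceEntry_perp hP hS₁ hS₂ hS₅ h₄.init h₅.init h₆)
      (W.traceEntry_perp hP hS₃ hS₂ hS₆ h₄.last h₅.init (h₅.perp _))
      (W.traceEntry_perp hP hS₃ hS₁ hS₄' h₇.last h₇.init (h₇.perp _))
      (W.traceEntry_perp hP hS₃ hS₂ hS₆ h₇.last h₈.init (h₈.perp _))
      (W.traceEntry_perp hP hS₁ hS₂ hS₅ h₇.init h₈.init h₉)

/-- Tracing out two lists of objects in either order gives the same result. -/
theorem traceEntry_comm (hP : P.FinitelyDisjoint) {n m : ℕ} {X : Fin n → C} {Y : Fin m → C}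
    {a b : C} {XX : ∀ i j, X i ⟶ X j} {XY : ∀ i j, X i ⟶ Y j} {Xb : ∀ i, X i ⟶ b}
    {YX : ∀ i j, Y i ⟶ X j} {YY : ∀ i j, Y i ⟶ Y j} {Yb : ∀ i, Y i ⟶ b}
    {aX : ∀ j, a ⟶ X j} {aY : ∀ j, a ⟶ Y j} {ab : a ⟶ b}
    (hX : ∀ i, P.RowDisjoint₂ (XX i) (XY i) (Xb i))
    (hY : ∀ i, P.RowDisjoint₂ (YX i) (YY i) (Yb i)) (ha : P.RowDisjoint₂ aX aY ab) :
    traceEntry W m Y (fun i j => traceEntry W n X XX (fun i' => XY i' j) (YX i) (YY i j))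
        (fun i => traceEntry W n X XX Xb (YX i) (Yb i))
        (fun j => traceEntry W n X XX (fun i' => XY i' j) aX (aY j))
        (traceEntry W n X XX Xb aX ab) =
      traceEntry W n X (fun i j => traceEntry W m Y YY (fun i' => YX i' j) (XY i) (XX i j))
        (fun i => traceEntry W m Y YY Yb (XY i) (Xb i))
        (fun j => traceEntry W m Y YY (fun i' => YX i' j) aY (aX j))
        (traceEntry W m Y YY Yb aY ab) := by
  induction m generalizing a b with
  | zero => rfl
  | succ m ih =>
    have hX₁ := fun i => (hX i).init
    have hX₂ := fun i => (hX i).last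
    have hY₁ := fun i : Fin m => (hY i.castSucc).init
    have hY₂ := fun i : Fin m => (hY i.castSucc).last
    have hY₃ := fun i : Fin m => (hY i.castSucc).snd.perp (Fin.last m)
    have hl := hY (Fin.last m)
    simp only [traceEntry_succ W Y]
    rw [ih hX₂ hY₂ hl.last, ih hX₁ hY₁ hl.init, ih hX₂ hY₂ ha.last, ih hX₁ hY₁ ha.init]
    have H₁ := fun i => (hY₁ i).symm
    have H₂ := fun i => (hY₂ i).symm
    exact W.traceEntry_trace₂_comm hP
      (fun i => W.traceEntry_rowDisjoint hP H₂ (hX₂ i).symm)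
      (fun i => W.traceEntry_rowDisjoint hP H₁ (hX₁ i).symm)
      (fun i => W.traceEntry_perp hP (fun i => (H₂ i).fst) (fun i => (H₁ i).fst) hY₃
        (hX₂ i).snd (hX₁ i).snd ((hX i).snd.perp _))
      (W.traceEntry_rowDisjoint hP H₂ hl.last.symm)
      (W.traceEntry_rowDisjoint hP H₁ hl.init.symm)
      (W.traceEntry_perp hP (fun i => (H₂ i).fst) (fun i => (H₁ i).fst) hY₃
        hl.last.snd hl.init.snd (hl.snd.perp _))
      (W.traceEntry_rowDisjoint hP H₂ ha.last.symm)
      (W.traceEntry_rowDisjoint hP H₁ ha.init.symm)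
      (W.traceEntry_perp hP (fun i => (H₂ i).fst) (fun i => (H₁ i).fst) hY₃
        ha.last.snd ha.init.snd (ha.snd.perp _))

end TraceEntry

end KleeneWand

end Interference

/-! ### Coproducts and quasi-projections -/

section Coproducts

variable {C : Type u} [Category.{v} C] [ChosenCoproducts C]

@[simp]
theorem inl_copair {X Y Z : C} (f : X ⟶ Z) (g : Y ⟶ Z) : inl X Y ≫ copair f g = f :=
  (ChosenCoproducts.isColimit X Y).fac (BinaryCofan.mk f g) ⟨WalkingPair.left⟩

@[simp]
theorem inr_copair {X Y Z : C} (f : X ⟶ Z) (g : Y ⟶ Z) : inr X Y ≫ copair f g = g :=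
  (ChosenCoproducts.isColimit X Y).fac (BinaryCofan.mk f g) ⟨WalkingPair.right⟩

@[simp]
theorem inl_copair_assoc {X Y Z T : C} (f : X ⟶ Z) (g : Y ⟶ Z) (h : Z ⟶ T) :
    inl X Y ≫ copair f g ≫ h = f ≫ h := by
  rw [← Category.assoc, inl_copair]

@[simp]
theorem inr_copair_assoc {X Y Z T : C} (f : X ⟶ Z) (g : Y ⟶ Z) (h : Z ⟶ T) :
    inr X Y ≫ copair f g ≫ h = g ≫ h := by
  rw [← Category.assoc, inr_copair]

theorem plus_hom_ext {X Y Z : C} {f g : plus X Y ⟶ Z} (h₁ : inl X Y ≫ f = inl X Y ≫ g)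
    (h₂ : inr X Y ≫ f = inr X Y ≫ g) : f = g :=
  BinaryCofan.IsColimit.hom_ext (ChosenCoproducts.isColimit X Y) h₁ h₂

@[simp]
theorem copair_comp {X Y Z T : C} (f : X ⟶ Z) (g : Y ⟶ Z) (h : Z ⟶ T) :
    copair f g ≫ h = copair (f ≫ h) (g ≫ h) :=
  plus_hom_ext (by simp) (by simp)

@[simp]
theorem inl_sumMap {X X' Y Y' : C} (f : X ⟶ X') (g : Y ⟶ Y') :
    inl X Y ≫ sumMap f g = f ≫ inl X' Y' := inl_copair _ _

@[simp]
theorem inr_sumMap {X X' Y Y' : C} (f : X ⟶ X') (g : Y ⟶ Y') :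
    inr X Y ≫ sumMap f g = g ≫ inr X' Y' := inr_copair _ _

@[simp]
theorem inl_sumMap_assoc {X X' Y Y' Z : C} (f : X ⟶ X') (g : Y ⟶ Y') (h : plus X' Y' ⟶ Z) :
    inl X Y ≫ sumMap f g ≫ h = f ≫ inl X' Y' ≫ h := by
  rw [← Category.assoc, inl_sumMap, Category.assoc]

@[simp]
theorem inr_sumMap_assoc {X X' Y Y' Z : C} (f : X ⟶ X') (g : Y ⟶ Y') (h : plus X' Y' ⟶ Z) :
    inr X Y ≫ sumMap f g ≫ h = g ≫ inr X' Y' ≫ h := by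
  rw [← Category.assoc, inr_sumMap, Category.assoc]

theorem hasBinaryCoproducts_of_chosen : HasBinaryCoproducts C :=
  have : ∀ X Y : C, HasColimit (pair X Y) := fun X Y => ⟨⟨⟨_, ChosenCoproducts.isColimit X Y⟩⟩⟩
  hasBinaryCoproducts_of_hasColimit_pair C

variable [HasZeroMorphisms C]

@[simp]
theorem inl_quasiFst (X Y : C) : inl X Y ≫ quasiFst X Y = 𝟙 X := inl_copair _ _

@[simp]
theorem inr_quasiFst (X Y : C) : inr X Y ≫ quasiFst X Y = 0 := inr_copair _ _

@[simp]
theorem inl_quasiSnd (X Y : C) : inl X Y ≫ quasiSnd X Y = 0 := inl_copair _ _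

@[simp]
theorem inr_quasiSnd (X Y : C) : inr X Y ≫ quasiSnd X Y = 𝟙 Y := inr_copair _ _

@[simp]
theorem inl_quasiFst_assoc {X Y Z : C} (f : X ⟶ Z) : inl X Y ≫ quasiFst X Y ≫ f = f := by
  rw [← Category.assoc, inl_quasiFst, Category.id_comp]

@[simp]
theorem inr_quasiFst_assoc {X Y Z : C} (f : X ⟶ Z) : inr X Y ≫ quasiFst X Y ≫ f = 0 := by
  rw [← Category.assoc, inr_quasiFst, zero_comp]

@[simp]
theorem inl_quasiSnd_assoc {X Y Z : C} (f : Y ⟶ Z) : inl X Y ≫ quasiSnd X Y ≫ f = 0 := by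
  rw [← Category.assoc, inl_quasiSnd, zero_comp]

@[simp]
theorem inr_quasiSnd_assoc {X Y Z : C} (f : Y ⟶ Z) : inr X Y ≫ quasiSnd X Y ≫ f = f := by
  rw [← Category.assoc, inr_quasiSnd, Category.id_comp]

@[simp]
theorem sumMap_quasiFst {X X' Y Y' : C} (f : X ⟶ X') (g : Y ⟶ Y') :
    sumMap f g ≫ quasiFst X' Y' = quasiFst X Y ≫ f :=
  plus_hom_ext (by simp) (by simp)

@[simp]
theorem sumMap_quasiSnd {X X' Y Y' : C} (f : X ⟶ X') (g : Y ⟶ Y') :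
    sumMap f g ≫ quasiSnd X' Y' = quasiSnd X Y ≫ g :=
  plus_hom_ext (by simp) (by simp)

theorem assocHom_quasiFst (X Y Z : C) :
    assocHom X Y Z ≫ quasiFst X (plus Y Z) = quasiFst (plus X Y) Z ≫ quasiFst X Y :=
  plus_hom_ext (plus_hom_ext (by simp [assocHom]) (by simp [assocHom])) (by simp [assocHom])

theorem assocHom_quasiSnd (X Y Z : C) :
    assocHom X Y Z ≫ quasiSnd X (plus Y Z) = sumMap (quasiSnd X Y) (𝟙 Z) :=
  plus_hom_ext (plus_hom_ext (by simp [assocHom]) (by simp [assocHom])) (by simp [assocHom])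

theorem assocHom_sumMap_quasiFst (X Y Z : C) :
    assocHom X Y Z ≫ sumMap (𝟙 X) (quasiFst Y Z) = quasiFst (plus X Y) Z :=
  plus_hom_ext (plus_hom_ext (by simp [assocHom]) (by simp [assocHom])) (by simp [assocHom])

theorem assocHom_sumMap_quasiSnd (X Y Z : C) :
    assocHom X Y Z ≫ sumMap (𝟙 X) (quasiSnd Y Z) = sumMap (quasiFst X Y) (𝟙 Z) :=
  plus_hom_ext (plus_hom_ext (by simp [assocHom]) (by simp [assocHom])) (by simp [assocHom])

end Coproducts

section Restriction

variable {C : Type u} [Category.{v} C] [RestrictionCategory C]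

/-- Split monomorphisms are total. -/
theorem isTotal_of_comp_eq_id {A B : C} {f : A ⟶ B} {r : B ⟶ A} (h : f ≫ r = 𝟙 A) :
    IsTotal f := by
  have := rest_comp_rest f r
  rwa [h, rest_id, Category.comp_id] at this

theorem rest_comp_of_isTotal {A B D : C} (f : A ⟶ B) {g : B ⟶ D} (hg : IsTotal g) :
    rest (f ≫ g) = rest f := by
  rw [← rest_comp_eq, hg, Category.comp_id]

end Restriction

/-! ### Decisions and extensivity from disjoint quasi-projections -/

namespace Interference

variable {C : Type u} [Category.{v} C] [RestrictionCategory C] [RestrictionZeroes C]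
  {P : Interference C}

namespace FinitelyDisjoint

variable (hP : P.FinitelyDisjoint)
include hP

theorem hasBinaryJoins : P.HasBinaryJoins := fun f g h =>
  ⟨f ⋎ g, hP.isLUB_join h, fun k => by
    rw [hP.comp_join h]
    exact hP.isLUB_join (P.perp_comp_left h k)⟩

theorem rest_join {A B : C} {f g : A ⟶ B} (h : P.perp f g) :
    RestrictionCategory.rest (f ⋎ g) =
      RestrictionCategory.rest f ⋎ RestrictionCategory.rest g := by
  rw [join_eq_lub_range, join_eq_lub_range, hP.rest_lub (disj_pair h)]
  congr 2
  funext b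
  cases b <;> rfl

end FinitelyDisjoint

section Quasi

variable [ChosenCoproducts C]

/-- The components of a map into a coproduct are disjoint if the quasi-projections are. -/
theorem perp_of_quasi (hq : ∀ X Y : C, P.perp (quasiFst X Y) (quasiSnd X Y)) {A B B' : C}
    {f : A ⟶ B} {g : A ⟶ B'} (h : A ⟶ plus B B') (h₁ : h ≫ quasiFst B B' = f)
    (h₂ : h ≫ quasiSnd B B' = g) : P.perp f g := by
  subst h₁ h₂
  exact P.perp_comp_left (hq B B') h

/-- The map into `X + Y` with components `f` and `g`. It is meaningful if they are disjoint. -/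
noncomputable def pairing {A X Y : C} (f : A ⟶ X) (g : A ⟶ Y) : A ⟶ plus X Y :=
  f ≫ inl X Y ⋎ g ≫ inr X Y

variable (hP : P.FinitelyDisjoint)
include hP

theorem pairing_quasiFst {A X Y : C} {f : A ⟶ X} {g : A ⟶ Y} (h : P.perp f g) :
    pairing f g ≫ quasiFst X Y = f := by
  rw [pairing, hP.join_comp (P.perp_comp_right h _ _)]
  simp [join_zero]

theorem pairing_quasiSnd {A X Y : C} {f : A ⟶ X} {g : A ⟶ Y} (h : P.perp f g) :
    pairing f g ≫ quasiSnd X Y = g := by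
  rw [pairing, hP.join_comp (P.perp_comp_right h _ _)]
  simp [zero_join]

theorem pairing_comp_copair {A X Y Z : C} {f : A ⟶ X} {g : A ⟶ Y} (h : P.perp f g) (k : X ⟶ Z)
    (l : Y ⟶ Z) : pairing f g ≫ copair k l = f ≫ k ⋎ g ≫ l := by
  rw [pairing, hP.join_comp (P.perp_comp_right h _ _)]
  simp

theorem comp_pairing {A' A X Y : C} {f : A ⟶ X} {g : A ⟶ Y} (h : P.perp f g) (k : A' ⟶ A) :
    k ≫ pairing f g = pairing (k ≫ f) (k ≫ g) := by
  rw [pairing, pairing, hP.comp_join (P.perp_comp_right h _ _), Category.assoc, Category.assoc]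

theorem pairing_comp_sumMap {A X X' Y Y' : C} {f : A ⟶ X} {g : A ⟶ Y} (h : P.perp f g)
    (k : X ⟶ X') (l : Y ⟶ Y') : pairing f g ≫ sumMap k l = pairing (f ≫ k) (g ≫ l) := by
  rw [sumMap, pairing_comp_copair hP h, pairing, Category.assoc, Category.assoc]

variable (hq : ∀ X Y : C, P.perp (quasiFst X Y) (quasiSnd X Y))
include hq

theorem pairing_quasi {A X Y : C} (h : A ⟶ plus X Y) :
    pairing (h ≫ quasiFst X Y) (h ≫ quasiSnd X Y) = h := by
  have h1 : pairing (quasiFst X Y) (quasiSnd X Y) = 𝟙 (plus X Y) := by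
    apply plus_hom_ext <;> rw [comp_pairing hP (hq X Y)] <;> simp [pairing, join_zero, zero_join]
  rw [← comp_pairing hP (hq X Y), h1, Category.comp_id]

theorem hom_plus_ext {A X Y : C} {h h' : A ⟶ plus X Y} (h₁ : h ≫ quasiFst X Y = h' ≫ quasiFst X Y)
    (h₂ : h ≫ quasiSnd X Y = h' ≫ quasiSnd X Y) : h = h' := by
  rw [← pairing_quasi hP hq h, ← pairing_quasi hP hq h', h₁, h₂]

/-- If the quasi-projections are disjoint, the separating decision of disjoint `f` and `g` is the
map with components `rest f` and `rest g`. -/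
theorem decisionDisjoint_iff {A B B' : C} (f : A ⟶ B) (g : A ⟶ B') :
    DecisionDisjoint f g ↔ P.perp f g := by
  constructor
  · rintro ⟨d, -, h₁, h₂⟩
    exact perp_of_rest (perp_of_quasi hq d h₁ h₂)
  · intro h
    have hr := P.rest h
    refine ⟨pairing (RestrictionCategory.rest f) (RestrictionCategory.rest g), ⟨?_, ?_⟩,
      pairing_quasiFst hP hr, pairing_quasiSnd hP hr⟩
    · rw [pairing_comp_copair hP hr, pairing, hP.rest_join (P.perp_comp_right hr _ _),
        rest_comp_of_isTotal _ (isTotal_of_comp_eq_id (inl_quasiFst A A)),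
        rest_comp_of_isTotal _ (isTotal_of_comp_eq_id (inr_quasiSnd A A)), rest_rest, rest_rest,
        Category.comp_id, Category.comp_id]
    · rw [pairing_comp_sumMap hP hr, pairing_comp_sumMap hP hr, comp_pairing hP hr,
        comp_pairing hP hr, rest_idem, rest_idem, P.rest_comp_rest_eq_zero h,
        P.rest_comp_rest_eq_zero (P.symm h)]
      simp [pairing, join_zero, zero_join]

/-- The decision of `f` is the join of the maps `rest (f πᵢ) ιᵢ`, where `πᵢ` are the
quasi-projections. -/
theorem isExtensive [HasInitial C] : IsExtensive C := by
  have := hasBinaryCoproducts_of_chosen (C := C)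
  have hfc : HasFiniteCoproducts C := hasFiniteCoproducts_of_has_binary_and_initial
  have hι : ∀ {n : ℕ} (B : Fin n → C) (i : Fin n), IsTotal (Limits.Sigma.ι B i) := fun B i =>
    isTotal_of_comp_eq_id (Sigma.ι_π_eq_id B i)
  refine { toHasFiniteCoproducts := hfc, total_injection := hι, decision := ?_ }
  intro n A B f
  have hπ : P.Disj (Sigma.π B) := by
    intro i j hij
    -- the map to `B i + B j` that sends `B i` to the left, `B j` to the right and the others to `0`
    refine perp_of_quasi hq (Limits.Sigma.desc fun k => if k = i then
      (Limits.Sigma.ι B k ≫ Sigma.π B i) ≫ inl _ _ else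
      (Limits.Sigma.ι B k ≫ Sigma.π B j) ≫ inr _ _) ?_ ?_
    all_goals
      refine Limits.Sigma.hom_ext _ _ fun k => ?_
      rw [← Category.assoc, Limits.Sigma.ι_desc]
      split_ifs with hk
    · simp
    · simp [Sigma.ι_π_of_ne B hk]
    · subst hk
      simp [Sigma.ι_π_of_ne B hij]
    · simp
  have hid : lub (Set.range fun i => Sigma.π B i ≫ Limits.Sigma.ι B i) = 𝟙 (∐ B) := by
    refine Limits.Sigma.hom_ext _ _ fun k => ?_
    rw [hP.comp_lub (hπ.comp_right _), lub_single _ k, ← Category.assoc, Sigma.ι_π_eq_id,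
      Category.id_comp, Category.comp_id]
    intro j hj
    rw [← Category.assoc, Sigma.ι_π_of_ne B hj.symm, zero_comp]
  have hr : ∀ i, RestrictionCategory.rest (Sigma.π B i) = Sigma.π B i ≫ Limits.Sigma.ι B i := by
    intro i
    rw [← rest_comp_of_isTotal _ (hι B i)]
    refine rest_of_le_one ?_
    rw [← hid]
    exact hP.le_lub (hπ.comp_right _) i
  have hf : lub (Set.range fun i => (f ≫ Sigma.π B i) ≫ Limits.Sigma.ι B i) = f := by
    conv_rhs => rw [← Category.comp_id f, ← hid, hP.comp_lub (hπ.comp_right _)]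
    simp only [Category.assoc]
  have hd := (hπ.comp_left f).rest
  refine ⟨lub (Set.range fun i => RestrictionCategory.rest (f ≫ Sigma.π B i) ≫
    Limits.Sigma.ι (fun _ => A) i), ?_, ?_⟩
  · rw [hP.lub_comp (hd.comp_right _)]
    conv_lhs => rw [← hf, hP.rest_lub ((hπ.comp_left f).comp_right _)]
    congr 2
    funext i
    rw [rest_comp_of_isTotal _ (hι B i), Category.assoc, Limits.Sigma.ι_desc, Category.comp_id]
  · rw [hP.lub_comp (hd.comp_right _)]
    conv_rhs => rw [← hf, hP.lub_comp ((hπ.comp_left f).comp_right _)]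
    congr 2
    funext i
    rw [Category.assoc, Category.assoc (f ≫ Sigma.π B i), Limits.Sigma.ι_map,
      Limits.Sigma.ι_map, ← Category.assoc, ← comp_rest, hr, Category.assoc, Category.assoc,
      Category.assoc]

end Quasi

end Interference

/-! ### From traces to Kleene wands -/

namespace TraceOperator

section

variable {C : Type u} [Category.{v} C] [ChosenCoproducts C] (T : TraceOperator C)

theorem comp_tr {X A A' B : C} (f : plus X A ⟶ plus X B) (g : A' ⟶ A) :
    g ≫ T.tr f = T.tr (sumMap (𝟙 X) g ≫ f) := by
  have h := T.tightening f g (𝟙 B)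
  have e : sumMap (𝟙 X) (𝟙 B) = 𝟙 _ := plus_hom_ext (by simp) (by simp)
  rw [e, Category.comp_id, Category.comp_id] at h
  exact h.symm

theorem tr_comp {X A B B' : C} (f : plus X A ⟶ plus X B) (h : B ⟶ B') :
    T.tr f ≫ h = T.tr (f ≫ sumMap (𝟙 X) h) := by
  have h := T.tightening f (𝟙 A) h
  have e : sumMap (𝟙 X) (𝟙 A) = 𝟙 _ := plus_hom_ext (by simp) (by simp)
  rw [e, Category.id_comp, Category.id_comp] at h
  exact h.symm

/-- The iteration of `H : X ⟶ X + A`: as long as the result lies in `X`, `H` is applied again. -/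
def iterate {X A : C} (H : X ⟶ plus X A) : X ⟶ A := T.tr (copair H H)

theorem iterate_comp {X A B : C} (H : X ⟶ plus X A) (k : A ⟶ B) :
    T.iterate H ≫ k = T.iterate (H ≫ sumMap (𝟙 X) k) := by
  rw [iterate, tr_comp, copair_comp, iterate]

/-- Iteration is dinatural, by sliding. -/
theorem iterate_comp_left {X Y A : C} (H : X ⟶ plus Y A) (k : Y ⟶ X) :
    T.iterate (k ≫ H) = k ≫ T.iterate (H ≫ sumMap k (𝟙 A)) := by
  rw [iterate, iterate, ← copair_comp H H, T.sliding, comp_tr]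
  congr 1
  exact plus_hom_ext (by simp) (by simp)

/-- Iterating until the result leaves the first copy of `X` and then iterating the outcome is
iterating with the two copies of `X` identified. This is vanishing for the matrix with three rows
`H`, combined with sliding along the codiagonal of `X`. -/
theorem iterate_iterate {X A : C} (H : X ⟶ plus (plus X X) A) :
    T.iterate (T.iterate (H ≫ assocHom X X A)) =
      T.iterate (H ≫ sumMap (copair (𝟙 X) (𝟙 X)) (𝟙 A)) := by
  have h₁ : T.iterate (H ≫ sumMap (copair (𝟙 X) (𝟙 X)) (𝟙 A)) =
      T.tr (copair (copair H H) H) := by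
    rw [iterate, ← copair_comp, T.sliding]
    congr 1
    refine plus_hom_ext (by simp) (by simp)
  rw [h₁, T.vanishing, iterate]
  congr 1
  rw [iterate]
  set t := H ≫ assocHom X X A with ht
  have h₂ : assocInv X X X ≫ copair (copair H H) H ≫ assocHom X X A = copair t (copair t t) := by
    rw [copair_comp, copair_comp]
    exact plus_hom_ext (by simp [assocInv, ht])
      (plus_hom_ext (by simp [assocInv, ht]) (by simp [assocInv, ht]))
  rw [h₂]
  refine plus_hom_ext ?_ ?_
  all_goals
    rw [comp_tr]
    simp only [inl_copair, inr_copair]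
    congr 1
    exact plus_hom_ext (by simp) (by simp)

end

open Interference

variable {C : Type u} [Category.{v} C] [RestrictionCategory C] [RestrictionZeroes C]
  {P : Interference C} [ChosenCoproducts C] (T : TraceOperator C)

/-- The Kleene wand `f ⩘ g = Tr [h; h]` induced by a trace operator, where `h` has the components
`f` and `g`. The assumption `hT` is the fixed point equation of the iteration. -/
noncomputable def kleeneWand (hP : P.FinitelyDisjoint)
    (hq : ∀ X Y : C, P.perp (quasiFst X Y) (quasiSnd X Y))
    (hT : ∀ {X A : C} (H : X ⟶ plus X A),
      T.iterate H = H ≫ copair (T.iterate H) (𝟙 A)) : P.KleeneWand where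
  wand f g _ := T.iterate (pairing f g)
  iteration f g h := by
    have h₁ := hP.isLUB_join (P.symm (P.perp_comp_right h (T.iterate (pairing f g)) (𝟙 _)))
    rwa [join_comm, ← pairing_comp_copair hP h, ← hT, Category.comp_id] at h₁
  naturality f g k h h' := by
    rw [iterate_comp, pairing_comp_sumMap hP h, Category.comp_id]
  dinaturality f g k h h₁ h₂ := by
    rw [← comp_pairing hP h, iterate_comp_left, pairing_comp_sumMap hP h, Category.comp_id]
  diagonal {X A} f f' g h j hj hjg hg := by
    obtain rfl : f ⋎ f' = j := lub_eq hj
    have hf'g : P.perp f' g := P.mono hjg ((hP.join_le_iff h _).1 le_rfl).2 le_rfl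
    have hp : P.perp (pairing f f') g :=
      hP.join_perp (P.perp_comp_right h _ _) (P.symm (perp_comp (P.symm hg) _))
        (P.symm (perp_comp (P.symm hf'g) _))
    set z := T.iterate (pairing (pairing f f') g ≫ assocHom X X A) with hz
    have h₁ : z ≫ quasiFst X A = T.iterate (pairing f f') := by
      rw [hz, iterate_comp, Category.assoc, assocHom_sumMap_quasiFst, pairing_quasiFst hP hp]
    have h₂ : z ≫ quasiSnd X A = T.iterate (pairing f g) := by
      rw [hz, iterate_comp, Category.assoc, assocHom_sumMap_quasiSnd, pairing_comp_sumMap hP hp,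
        Category.comp_id, pairing_quasiFst hP h]
    refine ⟨perp_of_quasi hq z h₁ h₂, ?_⟩
    rw [← h₁, ← h₂, pairing_quasi hP hq, hz, iterate_iterate, pairing_comp_sumMap hP hp,
      pairing_comp_copair hP h, Category.comp_id, Category.comp_id, Category.comp_id]

end TraceOperator

/-! ### Disjointness of matrices -/

namespace MAT

open Interference

variable {C : Type u} [Category.{v} C] [RestrictionCategory C] [RestrictionZeroes C]
  {P : Interference C} {hP : P.FinitelyDisjoint}

/-- Matrices are ordered entrywise. -/
theorem le_iff {A B : MAT P hP} (F G : A ⟶ B) : F ≤ G ↔ ∀ i j, F.val i j ≤ G.val i j := by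
  have hr : ∀ i j, (rest F ≫ G).val i j = rowRest F i ≫ G.val i j := diag_mul (rowRest F) G
  constructor
  · intro h i j
    have h' : F.val i j = rowRest F i ≫ G.val i j := by
      rw [← hr, (le_def F G).1 h]
    rw [h']
    simpa using comp_mono (rowRest_le_one F i) (le_refl (G.val i j))
  · intro h
    rw [le_def]
    ext i j
    rw [hr, rowRest, hP.lub_comp (F.disj i).rest, lub_single _ j]
    · exact h i j
    · intro k hk
      rw [← (le_def _ _).1 (h i k), rest_rest_comp, Category.assoc,
        P.rest_comp_eq_zero (G.disj i k j hk), comp_zero]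

@[simp] theorem zero_val {A B : MAT P hP} (i : Fin A.len) (j : Fin B.len) :
    (0 : A ⟶ B).val i j = 0 := rfl

theorem id_val_self {A : MAT P hP} (i : Fin A.len) : (𝟙 A : A ⟶ A).val i i = 𝟙 (A.obj i) := by
  change (diag A fun i => 𝟙 (A.obj i)).val i i = _
  simp [diag]

theorem id_val_of_ne {A : MAT P hP} {i j : Fin A.len} (h : i ≠ j) :
    (𝟙 A : A ⟶ A).val i j = 0 := by
  change (diag A fun i => 𝟙 (A.obj i)).val i j = _
  simp [diag, h]

theorem perp_comp_val {A B B' D D' : MAT P hP} {F : A ⟶ B} {G : A ⟶ B'} (K : B ⟶ D)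
    (K' : B' ⟶ D') (i : Fin A.len) (h : ∀ j k, P.perp (F.val i j) (G.val i k)) (j : Fin D.len)
    (k : Fin D'.len) : P.perp ((F ≫ K).val i j) ((G ≫ K').val i k) :=
  hP.perp_lub (disj_comp F K i j) (disj_comp G K' i k) fun l l' =>
    P.perp_comp_right (h l l') _ _

/-- Two matrices with the same domain are disjoint if they have disjoint rows, that is, if putting
them side by side gives a matrix with disjoint rows. -/
def interference (P : Interference C) (hP : P.FinitelyDisjoint) : Interference (MAT P hP) where
  perp {A B B'} F G := ∀ (i : Fin A.len) (j : Fin B.len) (k : Fin B'.len),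
    P.perp (F.val i j) (G.val i k)
  one_perp_zero A B i j k := P.perp_zero _
  symm h i j k := P.symm (h i k j)
  eq_zero h := hom_ext fun i j => P.eq_zero (h i j j)
  mono h hF hG i j k := P.mono (h i j k) ((le_iff _ _).1 hF i j) ((le_iff _ _).1 hG i k)
  comp {A' A B B' D D'} F G H K K' h i j k := by
    refine hP.perp_lub (disj_comp H (F ≫ K) i j) (disj_comp H (G ≫ K') i k) fun l l' => ?_
    by_cases hl : l = l'
    · subst hl
      exact P.perp_comp_left (perp_comp_val K K' l (h l) j k) _
    · exact P.perp_comp_right (H.disj i l l' hl) _ _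
  rest {A B B'} F G h i j k := by
    have hr : P.perp (rowRest F i) (rowRest G i) :=
      hP.perp_lub (F.disj i).rest (G.disj i).rest fun j k => P.rest (h i j k)
    change P.perp ((diag A (rowRest F)).val i j) ((diag A (rowRest G)).val i k)
    simp only [diag]
    split_ifs
    · exact P.perp_comp_right hr _ _
    · exact P.perp_zero _
    · exact perp_zero_left _
    · exact P.perp_zero _

/-- The entrywise join of a disjoint family of matrices. -/
noncomputable def sup {A B : MAT P hP} {ι : Type} [Finite ι] (F : ι → (A ⟶ B))
    (hF : (interference P hP).Disj F) : A ⟶ B where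
  val i j := lub (Set.range fun c => (F c).val i j)
  disj i j k hjk := hP.perp_lub (fun c c' hc => hF c c' hc i j j) (fun c c' hc => hF c c' hc i k k)
    fun c c' => by
      by_cases hc : c = c'
      · subst hc
        exact (F c).disj i j k hjk
      · exact hF c c' hc i j k

theorem isLUB_sup {A B : MAT P hP} {ι : Type} [Finite ι] {F : ι → (A ⟶ B)}
    (hF : (interference P hP).Disj F) : IsLUB (Set.range F) (sup F hF) := by
  have h : ∀ i j, P.Disj fun c => (F c).val i j := fun i j c c' hc => hF c c' hc i j j
  constructor
  · rintro _ ⟨c, rfl⟩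
    exact (le_iff _ _).2 fun i j => hP.le_lub (h i j) c
  · intro G hG
    exact (le_iff _ _).2 fun i j => (hP.lub_le_iff (h i j) _).2 fun c =>
      (le_iff _ _).1 (hG ⟨c, rfl⟩) i j

theorem comp_sup {A' A B : MAT P hP} {ι : Type} [Finite ι] {F : ι → (A ⟶ B)}
    (hF : (interference P hP).Disj F) (H : A' ⟶ A) :
    H ≫ sup F hF = sup (fun c => H ≫ F c) (hF.comp_left H) := by
  ext i k
  have h : ∀ j, P.Disj fun c => (F c).val j k := fun j c c' hc => hF c c' hc j k k
  refine eq_of_forall_ge_iff fun x => ?_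
  change lub (Set.range fun j => H.val i j ≫ lub (Set.range fun c => (F c).val j k)) ≤ x ↔
    lub (Set.range fun c => lub (Set.range fun j => H.val i j ≫ (F c).val j k)) ≤ x
  rw [hP.lub_le_iff (f := fun j => H.val i j ≫ lub (Set.range fun c => (F c).val j k))
      (disj_comp H (sup F hF) i k), hP.lub_le_iff (f := fun c => lub (Set.range fun j => H.val i j ≫ (F c).val j k))
      fun c c' hc => (hF.comp_left H) c c' hc i k k]
  simp only [hP.comp_lub (h _), hP.lub_le_iff (disj_comp H (F _) i k),
    hP.lub_le_iff ((h _).comp_left _)]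
  exact forall_comm

theorem finitelyDisjoint : (interference P hP).FinitelyDisjoint where
  exists_join F hF := ⟨sup F hF, isLUB_sup hF⟩
  stable F hF J hJ A' H := by
    obtain rfl := hJ.unique (isLUB_sup hF)
    rw [comp_sup]
    exact isLUB_sup _
  strong F hF J hJ D H h := by
    obtain rfl := hJ.unique (isLUB_sup hF)
    exact fun i j k => hP.strong _ (fun c c' hc => hF c c' hc i j j) _
      (hP.isLUB fun c c' hc => hF c c' hc i j j) _ fun c => h c i j k

theorem join_val {A B : MAT P hP} {F G : A ⟶ B} (h : (interference P hP).perp F G)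
    (i : Fin A.len) (j : Fin B.len) : (F ⋎ G).val i j = F.val i j ⋎ G.val i j := by
  rw [join_eq_lub_range, lub_eq (isLUB_sup (disj_pair h)), join_eq_lub_range]
  change lub _ = _
  congr 2
  funext b
  cases b <;> rfl

theorem inl_comp_val {A B D : MAT P hP} (F : plus A B ⟶ D) (i : Fin A.len) (k : Fin D.len) :
    (inl A B ≫ F).val i k = eqToHom (append_obj_left A B i) ≫ F.val (posLeft A B i) k :=
  injLeft_comp F i k

theorem inr_comp_val {A B D : MAT P hP} (F : plus A B ⟶ D) (i : Fin B.len) (k : Fin D.len) :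
    (inr A B ≫ F).val i k = eqToHom (append_obj_right A B i) ≫ F.val (posRight A B i) k :=
  injRight_comp F i k

theorem exists_eq_posLeft_or_posRight {A B : MAT P hP} (j : Fin (append A B).len) :
    (∃ a, j = posLeft A B a) ∨ ∃ b, j = posRight A B b :=
  Fin.addCases (motive := fun j => (∃ a, j = posLeft A B a) ∨ ∃ b, j = posRight A B b)
    (fun a => .inl ⟨a, rfl⟩) (fun b => .inr ⟨b, rfl⟩) j

/-- The matrix `stack (𝟙 A) 0` is the first quasi-projection. -/
theorem comp_stack_id_zero_val {D A B : MAT P hP} (F : D ⟶ append A B) (i : Fin D.len)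
    (k : Fin A.len) : (F ≫ (stack (𝟙 A) 0 : append A B ⟶ A)).val i k =
      F.val i (posLeft A B k) ≫ eqToHom (append_obj_left A B k).symm := by
  rw [comp_val, lub_single _ (posLeft A B k), stack_left, id_val_self, Category.comp_id]
  intro j hj
  obtain ⟨a, rfl⟩ | ⟨b, rfl⟩ := exists_eq_posLeft_or_posRight j
  · rw [stack_left, id_val_of_ne (fun h => hj (congrArg _ h)), comp_zero, comp_zero]
  · rw [stack_right, zero_val, comp_zero, comp_zero]

/-- The matrix `stack 0 (𝟙 B)` is the second quasi-projection. -/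
theorem comp_stack_zero_id_val {D A B : MAT P hP} (F : D ⟶ append A B) (i : Fin D.len)
    (k : Fin B.len) : (F ≫ (stack 0 (𝟙 B) : append A B ⟶ B)).val i k =
      F.val i (posRight A B k) ≫ eqToHom (append_obj_right A B k).symm := by
  rw [comp_val, lub_single _ (posRight A B k), stack_right, id_val_self, Category.comp_id]
  intro j hj
  obtain ⟨a, rfl⟩ | ⟨b, rfl⟩ := exists_eq_posLeft_or_posRight j
  · rw [stack_left, zero_val, comp_zero, comp_zero]
  · rw [stack_right, id_val_of_ne (fun h => hj (congrArg _ h)), comp_zero, comp_zero]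

theorem comp_quasiFst_val {D A B : MAT P hP} (F : D ⟶ plus A B) (i : Fin D.len)
    (k : Fin A.len) : (F ≫ quasiFst A B).val i k =
      F.val i (posLeft A B k) ≫ eqToHom (append_obj_left A B k).symm :=
  comp_stack_id_zero_val F i k

theorem comp_quasiSnd_val {D A B : MAT P hP} (F : D ⟶ plus A B) (i : Fin D.len)
    (k : Fin B.len) : (F ≫ quasiSnd A B).val i k =
      F.val i (posRight A B k) ≫ eqToHom (append_obj_right A B k).symm :=
  comp_stack_zero_id_val F i k

theorem quasi_perp (X Y : MAT P hP) :
    (interference P hP).perp (quasiFst X Y) (quasiSnd X Y) := by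
  intro i j k
  rw [← Category.id_comp (quasiFst X Y), ← Category.id_comp (quasiSnd X Y), comp_quasiFst_val,
    comp_quasiSnd_val]
  refine P.perp_comp_right ((𝟙 (plus X Y) : plus X Y ⟶ plus X Y).disj i _ _ fun h => ?_) _ _
  have h' := congrArg Fin.val h
  simp only [posLeft, posRight, Fin.val_castAdd, Fin.val_natAdd] at h'
  have := j.isLt
  omega

instance : HasInitial (MAT P hP) :=
  have : ∀ B : MAT P hP, Unique ((⟨0, Fin.elim0⟩ : MAT P hP) ⟶ B) := fun _ =>
    { default := 0
      uniq := fun _ => hom_ext fun i => i.elim0 }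
  hasInitial_of_unique ⟨0, Fin.elim0⟩

/-! ### The trace of matrices -/

variable (W : P.KleeneWand)

theorem rowDisjoint {X A B : MAT P hP} (H : A ⟶ plus X B) (i : Fin A.len) (j : Fin B.len) :
    P.RowDisjoint ((H ≫ quasiFst X B).val i) ((H ≫ quasiSnd X B).val i j) :=
  ⟨Hom.disj _ i, fun _ => perp_of_quasi quasi_perp H rfl rfl i _ j⟩

/-- The trace along `X` of the matrix with the rows of `H` above those of `R`; every entry is given
by the inductive trace formula. -/
noncomputable def stackTrace {X A B : MAT P hP} (H : X ⟶ plus X B) (R : A ⟶ plus X B) :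
    A ⟶ B where
  val i j := traceEntry W X.len X.obj (H ≫ quasiFst X B).val
    (fun i' => (H ≫ quasiSnd X B).val i' j) ((R ≫ quasiFst X B).val i)
    ((R ≫ quasiSnd X B).val i j)
  disj i j k hjk := W.traceEntry_perp hP (fun _ => rowDisjoint H _ _) (fun _ => rowDisjoint H _ _)
    (fun i' => Hom.disj _ i' j k hjk) (rowDisjoint R _ _) (rowDisjoint R _ _)
    (Hom.disj _ i j k hjk)

section

variable {X A B : MAT P hP} (H : X ⟶ plus X B)

theorem stackTrace_val (R : A ⟶ plus X B) (i : Fin A.len) (j : Fin B.len) :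
    (stackTrace W H R).val i j = traceEntry W X.len X.obj (H ≫ quasiFst X B).val
      (fun i' => (H ≫ quasiSnd X B).val i' j) ((R ≫ quasiFst X B).val i)
      ((R ≫ quasiSnd X B).val i j) := rfl

theorem comp_stackTrace {A' : MAT P hP} (R : A ⟶ plus X B) (g : A' ⟶ A) :
    g ≫ stackTrace W H R = stackTrace W H (g ≫ R) := by
  ext i j
  rw [stackTrace_val, Category.assoc, Category.assoc]
  exact (W.traceEntry_row hP (fun _ => rowDisjoint H _ _) (g.disj i)
    fun c => rowDisjoint R c j).symm

theorem stackTrace_comp {B' : MAT P hP} (R : A ⟶ plus X B) (h : B ⟶ B') :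
    stackTrace W H R ≫ h =
      stackTrace W (H ≫ sumMap (𝟙 X) h) (R ≫ sumMap (𝟙 X) h) := by
  ext i j
  simp only [stackTrace_val, Category.assoc, sumMap_quasiFst, sumMap_quasiSnd, Category.comp_id]
  simp only [← Category.assoc]
  exact (W.traceEntry_column hP (fun c => h.val c j) (fun _ _ => rowDisjoint H _ _)
    (Hom.disj _) (fun c => rowDisjoint R i c) (Hom.disj _ i) (Hom.disj _) (Hom.disj _ i)).symm

theorem stackTrace_comp_inr (k : A ⟶ B) : stackTrace W H (k ≫ inr X B) = k := by
  ext i j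
  rw [stackTrace_val]
  simp only [Category.assoc, inr_quasiFst, inr_quasiSnd, comp_zero, Category.comp_id]
  exact W.traceEntry_row_zero hP _ fun _ => rowDisjoint H _ _

variable {H}

theorem stackTrace_of_quasiSnd_eq_zero {R : A ⟶ plus X B} (hH : H ≫ quasiSnd X B = 0)
    (hR : R ≫ quasiSnd X B = 0) : stackTrace W H R = 0 := by
  ext i j
  rw [stackTrace_val, hH, hR]
  exact W.traceEntry_column_zero hP _ _ (Hom.disj _)

theorem stackTrace_of_quasiFst_eq_zero (R : A ⟶ plus X B) (hH : H ≫ quasiFst X B = 0) :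
    stackTrace W H R = R ≫ quasiSnd X B ⋎ (R ≫ quasiFst X B) ≫ (H ≫ quasiSnd X B) := by
  ext i j
  have hp := (interference P hP).symm (perp_of_quasi quasi_perp R rfl rfl)
  rw [stackTrace_val, hH, join_val (perp_comp hp _), comp_val]
  exact W.traceEntry_loop_zero hP _ (rowDisjoint R i j)

variable (H)

/-- Starting at an object that is traced out is the same as starting after one step. -/
theorem stackTrace_inl : stackTrace W H (inl X B) = stackTrace W H H := by
  ext i j
  rw [stackTrace_val, inl_quasiFst, inl_quasiSnd]
  exact W.traceEntry_unit_row hP (fun _ => rowDisjoint H _ _) i (id_val_self i)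
    fun j hj => id_val_of_ne hj.symm

/-- The trace is determined by the iteration of `H`: a row `R` goes to `X` or to `B`, and in the
first case `H` is iterated. -/
theorem stackTrace_eq (R : A ⟶ plus X B) :
    stackTrace W H R = R ≫ copair (stackTrace W H H) (𝟙 B) := by
  have h : stackTrace W H (𝟙 _) = copair (stackTrace W H H) (𝟙 B) := by
    apply plus_hom_ext <;> rw [comp_stackTrace, Category.comp_id]
    · rw [stackTrace_inl, inl_copair]
    · rw [← Category.id_comp (inr X B), stackTrace_comp_inr, Category.id_comp, inr_copair]
  rw [← h, comp_stackTrace, Category.comp_id]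

end

/-! ### The trace operator of the matrix category -/

theorem traceEntry_zero_eq_comp {A X B : MAT P hP} (F : A ⟶ X) (G : X ⟶ B) (i : Fin A.len)
    (j : Fin B.len) :
    traceEntry W X.len X.obj (fun _ _ => 0) (fun l => G.val l j) (F.val i) 0 =
      (F ≫ G).val i j := by
  rw [W.traceEntry_loop_zero hP _ ⟨F.disj i, fun _ => P.perp_zero _⟩, zero_join]
  rfl

/-- Both sides arise from the matrix with rows and columns `X`, `X'` whose only nonzero entries
among `X` and `X'` are those of `H : X ⟶ X'` and `k : X' ⟶ X`: the left hand side by tracing out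
first `X'` and then `X`, the right hand side by tracing out first `X` and then `X'`. -/
theorem stackTrace_sliding {X X' A B : MAT P hP} (H : X ⟶ plus X' B) (R : A ⟶ plus X' B)
    (k : X' ⟶ X) :
    stackTrace W (H ≫ sumMap k (𝟙 B)) (R ≫ sumMap k (𝟙 B)) = stackTrace W (k ≫ H) R := by
  ext i j
  have hc := W.traceEntry_comm hP (X := X'.obj) (Y := X.obj) (XX := fun _ _ => 0) (XY := k.val)
    (Xb := fun _ => 0) (YX := (H ≫ quasiFst X' B).val) (YY := fun _ _ => 0)
    (Yb := fun i => (H ≫ quasiSnd X' B).val i j) (aX := (R ≫ quasiFst X' B).val i)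
    (aY := fun _ => 0) (ab := (R ≫ quasiSnd X' B).val i j)
    (fun i => ⟨.zero _, ⟨k.disj i, fun _ => P.perp_zero _⟩, fun _ _ => perp_zero_left _⟩)
    (fun i => ⟨rowDisjoint H i j, .zero _, fun _ _ => P.perp_zero _⟩)
    ⟨rowDisjoint R i j, .zero _, fun _ _ => P.perp_zero _⟩
  have hcol : ∀ {a b : C} (r : ∀ l, a ⟶ X'.obj l) (q : a ⟶ b),
      traceEntry W X'.len X'.obj (fun _ _ => 0) (fun _ => 0) r q = q := fun r q =>
    W.traceEntry_column_zero hP r q fun _ _ _ _ => P.perp_zero _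
  have hrow : ∀ {a b : C} (r : ∀ l, X.obj l ⟶ b) (q : a ⟶ b),
      traceEntry W X.len X.obj (fun _ _ => 0) r (fun _ => 0) q = q := fun r q =>
    W.traceEntry_row_zero hP q fun _ => .zero _
  simp only [traceEntry_zero_eq_comp, hcol, hrow] at hc
  simp only [stackTrace_val, Category.assoc, sumMap_quasiFst, sumMap_quasiSnd, Category.comp_id]
  simp only [← Category.assoc] at hc ⊢
  exact hc

theorem stackTrace_comp_val {X A B D : MAT P hP} (H : X ⟶ plus X B) (R : A ⟶ plus X B)
    (h : B ⟶ D) (i : Fin A.len) (j : Fin D.len) :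
    (stackTrace W H R ≫ h).val i j = traceEntry W X.len X.obj (H ≫ quasiFst X B).val
      (fun i' => (H ≫ quasiSnd X B ≫ h).val i' j) ((R ≫ quasiFst X B).val i)
      ((R ≫ quasiSnd X B ≫ h).val i j) := by
  rw [stackTrace_comp, stackTrace_val]
  simp only [Category.assoc, sumMap_quasiFst, sumMap_quasiSnd, Category.comp_id]

section Blocks

variable {X A Y B : MAT P hP} (F : plus X A ⟶ plus Y B)

theorem inl_comp_quasiFst_val (i : Fin X.len) (j : Fin Y.len) :
    (inl X A ≫ F ≫ quasiFst Y B).val i j = block11 F i j :=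
  (inl_comp_val _ i j).trans (congrArg _ (comp_quasiFst_val F _ j))

theorem inl_comp_quasiSnd_val (i : Fin X.len) (j : Fin B.len) :
    (inl X A ≫ F ≫ quasiSnd Y B).val i j = block12 F i j :=
  (inl_comp_val _ i j).trans (congrArg _ (comp_quasiSnd_val F _ j))

theorem inr_comp_quasiFst_val (i : Fin A.len) (j : Fin Y.len) :
    (inr X A ≫ F ≫ quasiFst Y B).val i j = block21 F i j :=
  (inr_comp_val _ i j).trans (congrArg _ (comp_quasiFst_val F _ j))

theorem inr_comp_quasiSnd_val (i : Fin A.len) (j : Fin B.len) :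
    (inr X A ≫ F ≫ quasiSnd Y B).val i j = block22 F i j :=
  (inr_comp_val _ i j).trans (congrArg _ (comp_quasiSnd_val F _ j))

theorem block21_perp_block22 (i : Fin A.len) (j : Fin Y.len) (k : Fin B.len) :
    P.perp (block21 F i j) (block22 F i k) := by
  rw [← inr_comp_quasiFst_val, ← inr_comp_quasiSnd_val, ← Category.assoc, ← Category.assoc]
  exact (rowDisjoint (inr X A ≫ F) i k).perp j

end Blocks

omit [RestrictionCategory C] [RestrictionZeroes C] in
theorem eq_eqToHom_conj {a a' b b' : C} {x : a ⟶ b} {y : a' ⟶ b'} (p : a' = a) (q : b = b')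
    (h : y = eqToHom p ≫ x ≫ eqToHom q) :
    x = eqToHom p.symm ≫ y ≫ eqToHom q.symm := by
  subst p q
  simp [h]

omit [RestrictionCategory C] [RestrictionZeroes C] in
theorem eq_eqToHom_conj_left {a a' b : C} {x : a ⟶ b} {y : a' ⟶ b} (p : a' = a)
    (h : y = eqToHom p ≫ x) : x = eqToHom p.symm ≫ y ≫ eqToHom rfl := by
  subst p
  simp [h]

omit [RestrictionCategory C] [RestrictionZeroes C] in
theorem eq_eqToHom_conj_right {a b b' : C} {x : a ⟶ b} {y : a ⟶ b'} (q : b = b')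
    (h : y = x ≫ eqToHom q) : x = eqToHom rfl ≫ y ≫ eqToHom q.symm := by
  subst q
  simp [h]

/-- Tracing out `X + Y` is tracing out `X` and then `Y`. -/
theorem stackTrace_plus {X Y A B : MAT P hP} (H : plus X Y ⟶ plus (plus X Y) B)
    (R : A ⟶ plus (plus X Y) B) :
    stackTrace W H R =
      stackTrace W
        (stackTrace W (inl X Y ≫ H ≫ assocHom X Y B) (inr X Y ≫ H ≫ assocHom X Y B))
        (stackTrace W (inl X Y ≫ H ≫ assocHom X Y B) (R ≫ assocHom X Y B)) := by
  ext i j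
  have h₂ : assocHom X Y B ≫ quasiSnd X (plus Y B) ≫ quasiFst Y B =
      quasiFst (plus X Y) B ≫ quasiSnd X Y := by
    rw [← Category.assoc, assocHom_quasiSnd, sumMap_quasiFst]
  have h₃ : assocHom X Y B ≫ quasiSnd X (plus Y B) ≫ quasiSnd Y B = quasiSnd (plus X Y) B := by
    rw [← Category.assoc, assocHom_quasiSnd, sumMap_quasiSnd, Category.comp_id]
  have h₁₁ := inl_comp_quasiFst_val (H ≫ quasiFst _ B)
  have h₁₂ := inl_comp_quasiSnd_val (H ≫ quasiFst _ B)
  have h₂₁ := inr_comp_quasiFst_val (H ≫ quasiFst _ B)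
  have h₂₂ := inr_comp_quasiSnd_val (H ≫ quasiFst _ B)
  have h₁ := comp_quasiFst_val (R ≫ quasiFst _ B)
  have h₁' := comp_quasiSnd_val (R ≫ quasiFst _ B)
  simp only [Category.assoc] at h₁₁ h₁₂ h₂₁ h₂₂ h₁ h₁'
  refine (W.traceEntry_add (n := X.len) (m := Y.len) (plus X Y).obj _ _ _ _).trans ?_
  refine (W.traceEntry_eqToHom (X' := Y.obj) (fun i => (append_obj_right X Y i).symm) rfl rfl
    (S' := (stackTrace W (inl X Y ≫ H ≫ assocHom X Y B) (inr X Y ≫ H ≫ assocHom X Y B) ≫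
      quasiFst Y B).val)
    (U' := fun i => (stackTrace W (inl X Y ≫ H ≫ assocHom X Y B)
      (inr X Y ≫ H ≫ assocHom X Y B) ≫ quasiSnd Y B).val i j)
    (R' := (stackTrace W (inl X Y ≫ H ≫ assocHom X Y B) (R ≫ assocHom X Y B) ≫
      quasiFst Y B).val i)
    (k' := (stackTrace W (inl X Y ≫ H ≫ assocHom X Y B) (R ≫ assocHom X Y B) ≫
      quasiSnd Y B).val i j) ?_ ?_ ?_ ?_).trans ?_
  · intro i j
    rw [stackTrace_comp_val]
    simp only [Category.assoc, assocHom_quasiFst, h₂]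
    exact W.traceEntry_eqToHom (X' := X.obj) (fun i => (append_obj_left X Y i).symm)
      (append_obj_right X Y i).symm (append_obj_right X Y j).symm
      (fun i j => eq_eqToHom_conj _ _ (h₁₁ i j)) (fun i => eq_eqToHom_conj _ _ (h₁₂ i j))
      (fun j => eq_eqToHom_conj _ _ (h₂₁ i j)) (eq_eqToHom_conj _ _ (h₂₂ i j))
  · intro i
    rw [stackTrace_comp_val]
    simp only [Category.assoc, assocHom_quasiFst, h₃]
    exact W.traceEntry_eqToHom (X' := X.obj) (fun i => (append_obj_left X Y i).symm)
      (append_obj_right X Y i).symm rfl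
      (fun i j => eq_eqToHom_conj _ _ (h₁₁ i j))
      (fun i => eq_eqToHom_conj_left _ (inl_comp_val (H ≫ quasiSnd _ B) i j))
      (fun j => eq_eqToHom_conj _ _ (h₂₁ i j))
      (eq_eqToHom_conj_left _ (inr_comp_val (H ≫ quasiSnd _ B) i j))
  · intro l
    rw [stackTrace_comp_val]
    simp only [Category.assoc, assocHom_quasiFst, h₂]
    exact W.traceEntry_eqToHom (X' := X.obj) (fun i => (append_obj_left X Y i).symm)
      rfl (append_obj_right X Y l).symm
      (fun i j => eq_eqToHom_conj _ _ (h₁₁ i j)) (fun i => eq_eqToHom_conj _ _ (h₁₂ i l))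
      (fun j => eq_eqToHom_conj_right _ (h₁ i j))
      (eq_eqToHom_conj_right _ (h₁' i l))
  · rw [stackTrace_comp_val]
    simp only [Category.assoc, assocHom_quasiFst, h₃]
    exact W.traceEntry_eqToHom (X' := X.obj) (fun i => (append_obj_left X Y i).symm)
      rfl rfl
      (fun i j => eq_eqToHom_conj _ _ (h₁₁ i j))
      (fun i => eq_eqToHom_conj_left _ (inl_comp_val (H ≫ quasiSnd _ B) i j))
      (fun j => eq_eqToHom_conj_right _ (h₁ i j))
      (by simp)
  · rw [stackTrace_val]
    simp

/-- The trace operator of the matrix category, given entrywise by the inductive trace formula. -/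
noncomputable def traceOperator (hP : P.FinitelyDisjoint) : TraceOperator (MAT P hP) where
  tr {X A B} F := stackTrace W (inl X A ≫ F) (inr X A ≫ F)
  tightening f g h := by
    simp only [inl_sumMap_assoc, inr_sumMap_assoc, Category.id_comp]
    rw [stackTrace_comp, comp_stackTrace]
    simp only [Category.assoc]
  sliding f k := by
    simp only [inl_sumMap_assoc, inr_sumMap_assoc, Category.id_comp]
    rw [← Category.assoc, ← Category.assoc, stackTrace_sliding]
  vanishing {X Y A B} f := by
    rw [stackTrace_plus]
    simp only [comp_stackTrace]
    simp [assocInv]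
  superposing {X A B D E} f g := by
    -- the four blocks of both sides agree
    refine plus_hom_ext (hom_plus_ext finitelyDisjoint quasi_perp ?_ ?_)
      (hom_plus_ext finitelyDisjoint quasi_perp ?_ ?_)
    all_goals
      rw [Category.assoc, stackTrace_comp, comp_stackTrace]
      simp only [assocInv, inl_copair_assoc, inr_copair_assoc, inl_sumMap_assoc, Category.assoc,
        inl_sumMap, inr_sumMap, inr_sumMap_assoc, assocHom_sumMap_quasiFst,
        assocHom_sumMap_quasiSnd, inl_quasiFst, inl_quasiSnd, inr_quasiFst, inr_quasiSnd,
        Category.id_comp, Category.comp_id, comp_zero]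
    · exact stackTrace_of_quasiSnd_eq_zero W (by simp) (by simp)
    · rw [← zero_comp (Y := B), stackTrace_comp_inr]
    · exact stackTrace_comp_inr W _ g
  yanking X := by
    rw [swap, inl_copair, inr_copair, stackTrace_of_quasiFst_eq_zero W _ (inr_quasiFst X X)]
    simp [zero_join]

theorem traceOperator_iterate {X A : MAT P hP} (H : X ⟶ plus X A) :
    (traceOperator W hP).iterate H = stackTrace W H H := by
  change stackTrace W (inl X X ≫ copair H H) (inr X X ≫ copair H H) = _
  rw [inl_copair, inr_copair]

end MAT

end RestrCat

theorem mainTheorem3 {C : Type u} [Category.{v} C] [RestrictionCategory C] [RestrictionZeroes C]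
    (P : Interference C) (hP : P.FinitelyDisjoint) (W : P.KleeneWand) :
    IsExtensive (MAT P hP) ∧
    ∃ T : TraceOperator (MAT P hP),
      -- the trace of a two-by-two matrix
      (∀ (X A B : C)
          (F : plus ((MAT.embed P hP).obj X) ((MAT.embed P hP).obj A) ⟶
            plus ((MAT.embed P hP).obj X) ((MAT.embed P hP).obj B)),
        ∃ j : A ⟶ B,
          IsLUB {MAT.block22 F (0 : Fin 1) (0 : Fin 1), MAT.block21 F (0 : Fin 1) (0 : Fin 1) ≫
            W.wand (MAT.block11 F (0 : Fin 1) (0 : Fin 1))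
              (MAT.block12 F (0 : Fin 1) (0 : Fin 1))
              (MAT.block11_perp_block12 F (0 : Fin 1) (0 : Fin 1) (0 : Fin 1))} j ∧
          T.tr F = (MAT.embed P hP).map j) ∧
      -- the trace of an arbitrary matrix
      (∀ (X A B : MAT P hP) (F : plus X A ⟶ plus X B) (i : Fin A.len) (j : Fin B.len),
        (T.tr F).val i j =
          traceEntry W X.len X.obj (MAT.block11 F) (fun a => MAT.block12 F a j)
            (fun b => MAT.block21 F i b) (MAT.block22 F i j)) ∧
      -- decision disjointness is an interference relation, the trace induces a Kleene wand for it,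
      -- and the embedding preserves the Kleene wands
      ∃ D : Interference (MAT P hP),
        (∀ {A B B' : MAT P hP} (F : A ⟶ B) (G : A ⟶ B'),
          D.perp F G ↔ DecisionDisjoint F G) ∧
        D.HasBinaryJoins ∧
        ∃ W' : D.KleeneWand,
          (∀ {X A : MAT P hP} (F : X ⟶ X) (G : X ⟶ A) (h : D.perp F G),
            ∃ H : X ⟶ plus X A, H ≫ quasiFst X A = F ∧ H ≫ quasiSnd X A = G ∧
              W'.wand F G h = T.tr (copair H H)) ∧
          ∀ {X A : C} (f : X ⟶ X) (g : X ⟶ A) (h : P.perp f g),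
            ∃ h' : D.perp ((MAT.embed P hP).map f) ((MAT.embed P hP).map g),
              (MAT.embed P hP).map (W.wand f g h) =
                W'.wand ((MAT.embed P hP).map f) ((MAT.embed P hP).map g) h' := by
  have hD := MAT.finitelyDisjoint (hP := hP)
  have hq := MAT.quasi_perp (hP := hP)
  have hb : ∀ (X A B : MAT P hP) (F : plus X A ⟶ plus X B) (i : Fin A.len) (j : Fin B.len),
      ((MAT.traceOperator W hP).tr F).val i j =
        traceEntry W X.len X.obj (MAT.block11 F) (fun a => MAT.block12 F a j)
          (fun b => MAT.block21 F i b) (MAT.block22 F i j) := by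
    intro X A B F i j
    refine (MAT.stackTrace_val W _ _ i j).trans ?_
    simp only [Category.assoc]
    congr 1
    · exact funext fun i => funext fun j => MAT.inl_comp_quasiFst_val F i j
    · exact funext fun i => MAT.inl_comp_quasiSnd_val F i j
    · exact funext fun j => MAT.inr_comp_quasiFst_val F i j
    · exact MAT.inr_comp_quasiSnd_val F i j
  refine ⟨Interference.isExtensive hD hq, MAT.traceOperator W hP, ?_, hb,
    MAT.interference P hP, fun F G => (Interference.decisionDisjoint_iff hD hq F G).symm,
    hD.hasBinaryJoins,
    (MAT.traceOperator W hP).kleeneWand hD hq ?_, ?_, ?_⟩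
  · intro X A B F
    have h := MAT.block11_perp_block12 F (0 : Fin 1) (0 : Fin 1) (0 : Fin 1)
    refine ⟨_, hP.isLUB_join ?_, ?_⟩
    · exact Interference.perp_comp (P.symm (MAT.block21_perp_block22 F _ _ _)) _
    · apply MAT.hom_ext
      intro (i : Fin 1) (j : Fin 1)
      obtain rfl := Subsingleton.elim i 0
      obtain rfl := Subsingleton.elim j 0
      refine (hb _ _ _ F (0 : Fin 1) (0 : Fin 1)).trans ((W.trace₂_eq h _ _).trans ?_)
      rw [W.iter_of_perp h]
      rfl
  · intro X A H
    rw [MAT.traceOperator_iterate]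
    exact MAT.stackTrace_eq W H H
  · exact fun F G h => ⟨_, Interference.pairing_quasiFst hD h, Interference.pairing_quasiSnd hD h,
      rfl⟩
  · intro X A f g h
    have h' : (MAT.interference P hP).perp ((MAT.embed P hP).map f) ((MAT.embed P hP).map g) :=
      fun _ _ _ => h
    refine ⟨h', ?_⟩
    apply MAT.hom_ext
    intro (i : Fin 1) (j : Fin 1)
    obtain rfl := Subsingleton.elim i 0
    obtain rfl := Subsingleton.elim j 0
    let p := Interference.pairing ((MAT.embed P hP).map f) ((MAT.embed P hP).map g)
    refine Eq.trans ?_ ((congrArg (fun H => H.val (0 : Fin 1) (0 : Fin 1))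
      (MAT.traceOperator_iterate W p)).trans
        (MAT.stackTrace_val W p p (0 : Fin 1) (0 : Fin 1))).symm
    rw [Interference.pairing_quasiFst hD h', Interference.pairing_quasiSnd hD h']
    refine Eq.trans ?_ (W.trace₂_eq h _ _).symm
    exact (W.iter_of_perp h).symm.trans (W.iter_eq h)
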